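/- All manifolds are smooth ($C^\infty$, Hausdorff, second countable, without boundary) and connected, and metrics are smooth and Riemannian. **Tractors.** Let $(M,g)$ be a Riemannian manifold of dimension $d\ge 3$, with Schouten tensor $P$ given by $\mathrm{Ric}=(d-2)P+Jg$, $J=\mathrm{tr}_gP$. In the scale $g$ a standard tractor field on $(M,[g])$ is a triple $U=(\sigma,\mu,\rho)$ consisting of a function, a vector field and a function. The tractor metric is $|U|^2=2\sigma\rho+|\mu|_g^2$ and the (normal) tractor connection is $$\nabla_u(\sigma,\mu,\rho)=\bigl(d\sigma(u)-g(\mu,u),\ \nabla_u\mu+\rho\,u+\sigma P^\sharp(u),\ d\rho(u)-P(u,\mu)\bigr).$$ If $(M,g)$ is Einstein ($\mathrm{Ric}=\Lambda g$ with $\Lambda$ constant) of dimension $d\in\{1,2\}$, the same formulas are used with $P:=c\,g$, where $c=\mathrm{Sc}^g/(2d(d-1))$ if $d=2$, and $c\in\mathbb R$ is any constant, chosen as part of the data, if $d=1$. The Einstein tractor of an Einstein manifold $(M,g)$ (with this connection) is the parallel tractor $I$ with $\sigma\equiv 1$ in the scale $g$. **Almost Einstein structures.** A *directed almost Einstein structure*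 on $(M,[g])$ is a smooth parallel standard tractor field $I\neq 0$. An *almost Einstein structure* on $(M,[g])$ is a family of smooth, parallel, nowhere zero standard tractor fields $I_U$ on the sets $U$ of an open cover of $M$ such that for all $U,V$ in the cover either $I_U=I_V$ on $U\cap V$ or $I_U=-I_V$ on $U\cap V$. Two directed structures are linearly independent if the tractor fields are; two almost Einstein structures are linearly independent if at every point their local tractors (defined up to sign) are. **Special Einstein products.** $(M_1^{m_1}\times M_2^{m_2},g_1\times g_2)$, with $m_1,m_2\ge 1$ and $m_1+m_2\ge 3$, is a *special Einstein product* if $(M_i,g_i)$, $i=1,2$, is Einstein with Einstein tractor $I_i$ and $|I_1|^2=-|I_2|^2\neq 0$. **Theorem.** Let $(M,g)=(M_1\times M_2,g_1\times g_2)$ be a special Einstein product. Then: 1. $(M,[g])$ admits a directed almost Einstein structure if and only if at least one of the factors $(M_1,[g_1])$, $(M_2,[g_2])$ admits at least two linearly independent directed almost Einstein structures. 2. $(M,[g])$ admits an almost Einstein structure if and only if at least one of the factors $(M_1,[g_1])$, $(M_2,[g_2])$ admits at least two linearly independent almost Einstein structures. -/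

import Mathlib

set_option maxSynthPendingDepth 3
set_option linter.unusedSectionVars false

open TopologicalSpace
open scoped Manifold ContDiff Topology

noncomputable section

namespace ConformalTractor

section Manifold

variable {E : Type*} [NormedAddCommGroup E] [NormedSpace ℝ E] [FiniteDimensional ℝ E]
  {H : Type*} [TopologicalSpace H] {I : ModelWithCorners ℝ E H}
  {M : Type*} [TopologicalSpace M] [ChartedSpace H M] [IsManifold I ∞ M]

/-! ### Levi-Civita connection and curvature, computed in charts

For a metric `g`, a point `x₀` and the preferred chart `φ` at `x₀`, the pulled back metric
`(φ⁻¹)^* g` is a function on the model vector space `E` with values in bilinear forms on `E`.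
All formulas below are written without a basis of `E`.  Tangent vectors at `x₀` are
identified with elements of `E` through `φ`, as everywhere in Mathlib. -/

variable (I M) in
/-- Smooth Riemannian metrics on `M`. -/
abbrev Metric := Bundle.ContMDiffRiemannianMetric I ∞ E (TangentSpace I : M → Type _)

/-- The metric `(φ⁻¹)^* g` on `E`, where `φ` is the preferred chart at `x₀`. -/
def chartMetric (g : Metric I M) (x₀ : M) (y : E) : E →L[ℝ] E →L[ℝ] ℝ :=
  let B : E →L[ℝ] E →L[ℝ] ℝ := g.inner ((extChartAt I x₀).symm y)
  let A : E →L[ℝ] E := mfderiv 𝓘(ℝ, E) I (extChartAt I x₀).symm y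
  B.bilinearComp A A

/-- The Koszul expression of a field `G` of bilinear forms on `E`, in constant directions:
`½ (D_u G (v, w) + D_v G (u, w) - D_w G (u, v))`, see `koszul_apply`. -/
def koszul (G : E → E →L[ℝ] E →L[ℝ] ℝ) (y : E) : E →L[ℝ] E →L[ℝ] E →L[ℝ] ℝ :=
  let D : E →L[ℝ] E →L[ℝ] E →L[ℝ] ℝ := fderiv ℝ G y
  let D' : E →L[ℝ] E →L[ℝ] E →L[ℝ] ℝ :=
    ((ContinuousLinearMap.flipₗᵢ ℝ E E ℝ).toContinuousLinearEquiv :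
      (E →L[ℝ] E →L[ℝ] ℝ) →L[ℝ] (E →L[ℝ] E →L[ℝ] ℝ)) ∘L D.flip
  (1 / 2 : ℝ) • (D + D.flip - D')

theorem koszul_apply (G : E → E →L[ℝ] E →L[ℝ] ℝ) (y u v w : E) :
    koszul G y u v w =
      (1 / 2) * (fderiv ℝ G y u v w + fderiv ℝ G y v u w - fderiv ℝ G y w u v) := rfl

/-- The Christoffel symbols of `G`: the bilinear map `Γ` with `G (Γ (u, v), w)` equal to the Koszul
expression. -/
def christoffel (G : E → E →L[ℝ] E →L[ℝ] ℝ) (y : E) : E →L[ℝ] E →L[ℝ] E :=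
  (ContinuousLinearMap.compL ℝ E (E →L[ℝ] ℝ) E (G y).inverse) ∘L koszul G y

theorem christoffel_apply (G : E → E →L[ℝ] E →L[ℝ] ℝ) (y u v : E) :
    christoffel G y u v = (G y).inverse (koszul G y u v) := rfl

/-- The curvature `u ↦ R (u, v) w` of the connection `D + Γ` on `E`, where
`R (u, v) = ∇_u ∇_v - ∇_v ∇_u - ∇_[u, v]`, see `curvature_apply`. -/
def curvature (Γ : E → E →L[ℝ] E →L[ℝ] E) (y v w : E) : E →L[ℝ] E :=
  let D : E →L[ℝ] E →L[ℝ] E →L[ℝ] E := fderiv ℝ Γ y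
  (D.flip v).flip w - (D v).flip w + (Γ y).flip (Γ y v w) - (Γ y v) ∘L (Γ y).flip w

theorem curvature_apply (Γ : E → E →L[ℝ] E →L[ℝ] E) (y u v w : E) :
    curvature Γ y v w u =
      fderiv ℝ Γ y u v w - fderiv ℝ Γ y v u w + Γ y u (Γ y v w) - Γ y v (Γ y u w) := rfl

/-- The Ricci tensor of a connection `D + Γ` on `E`: the trace of `u ↦ R (u, v) w`. -/
def chartRicci (Γ : E → E →L[ℝ] E →L[ℝ] E) (y : E) : E →L[ℝ] E →L[ℝ] ℝ :=
  LinearMap.toContinuousBilinearMap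
    (LinearMap.mk₂ ℝ (fun v w : E => LinearMap.trace ℝ E (curvature Γ y v w : E →ₗ[ℝ] E))
      (fun v v' w => by
        rw [← map_add]; congr 1; ext u
        simp [curvature_apply]; abel)
      (fun c v w => by
        rw [← map_smul]; congr 1; ext u
        simp [curvature_apply, smul_sub, smul_add])
      (fun v w w' => by
        rw [← map_add]; congr 1; ext u
        simp [curvature_apply]; abel)
      (fun c v w => by
        rw [← map_smul]; congr 1; ext u
        simp [curvature_apply, smul_sub, smul_add]))

theorem chartRicci_apply (Γ : E → E →L[ℝ] E →L[ℝ] E) (y v w : E) :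
    chartRicci Γ y v w = LinearMap.trace ℝ E (curvature Γ y v w : E →ₗ[ℝ] E) := rfl

/-- The Ricci tensor of `g` at `x`. -/
def ricci (g : Metric I M) (x : M) : TangentSpace I x →L[ℝ] TangentSpace I x →L[ℝ] ℝ :=
  (chartRicci (christoffel (chartMetric g x)) (extChartAt I x x) : E →L[ℝ] E →L[ℝ] ℝ)

/-- Raising an index: the endomorphism `B♯` of `T_x M` with `g (B♯ u, w) = B (u, w)`. -/
def raise (g : Metric I M) (x : M) (B : TangentSpace I x →L[ℝ] TangentSpace I x →L[ℝ] ℝ) :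
    TangentSpace I x →L[ℝ] TangentSpace I x :=
  (g.inner x).inverse ∘L B

/-- The scalar curvature, the metric trace of the Ricci tensor. -/
def scal (g : Metric I M) (x : M) : ℝ :=
  LinearMap.trace ℝ (TangentSpace I x) (raise g x (ricci g x)).toLinearMap

/-- The Schouten tensor in dimension `d ≥ 3`, defined by `Ric = (d - 2) P + J g` where `J` is the
metric trace of `P`, so that `J = Sc / (2 (d - 1))`. -/
def schouten (g : Metric I M) (x : M) : TangentSpace I x →L[ℝ] TangentSpace I x →L[ℝ] ℝ :=
  (1 / ((Module.finrank ℝ E : ℝ) - 2)) •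
    (ricci g x - (scal g x / (2 * ((Module.finrank ℝ E : ℝ) - 1))) • g.inner x)

/-- The Levi-Civita covariant derivative `u ↦ ∇_u t` of a vector field `t` at `x`. -/
def covDeriv (g : Metric I M) (t : Π x : M, TangentSpace I x) (x : M) :
    TangentSpace I x →L[ℝ] TangentSpace I x :=
  let y : E := extChartAt I x x
  let t' : E → E := VectorField.mpullback 𝓘(ℝ, E) I (extChartAt I x).symm t
  (fderiv ℝ t' y + (christoffel (chartMetric g x) y).flip (t' y) : E →L[ℝ] E)

/-! ### Tractors

A metric `g` in the conformal class trivialises the density bundles and splits the standard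
tractor bundle, and a tractor field becomes a triple `(σ, μ, ρ)`, where `σ`, `ρ` are functions
and `μ` is a vector field. -/

variable (I) in
/-- The fibre at `x` of the standard tractor bundle, in the scale `g`. -/
abbrev TractorFibre (x : M) := ℝ × TangentSpace I x × ℝ

variable (I M) in
/-- Tractor fields, in the scale `g` (no regularity is required here). -/
abbrev TractorField := Π x : M, TractorFibre I x

/-- The tractor metric `h (U, U) = 2 σ ρ + g (μ, μ)`. -/
def tractorNormSq (g : Metric I M) (x : M) (U : TractorFibre I x) : ℝ :=
  2 * U.1 * U.2.2 + g.inner x U.2.1 U.2.1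

/-- The tractor connection determined by a metric `g` and a "Schouten tensor" `P`:
`∇_u (σ, μ, ρ) = (∇_u σ - g (μ, u), ∇_u μ + ρ u + σ P♯ u, ∇_u ρ - P (u, μ))`. -/
def tractorConnection (g : Metric I M)
    (P : Π x : M, TangentSpace I x →L[ℝ] TangentSpace I x →L[ℝ] ℝ)
    (V : TractorField I M) (x : M) (u : TangentSpace I x) : TractorFibre I x :=
  (mvfderiv I (fun z => (V z).1) x u - g.inner x (V x).2.1 u,
   covDeriv g (fun z => (V z).2.1) x u + (V x).2.2 • u + (V x).1 • raise g x (P x) u,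
   mvfderiv I (fun z => (V z).2.2) x u - P x u (V x).2.1)

/-- A tractor field is smooth on `U` if its three components are. -/
structure IsSmoothOn (V : TractorField I M) (U : Set M) : Prop where
  scale : ContMDiffOn I 𝓘(ℝ, ℝ) ∞ (fun x => (V x).1) U
  vector : ContMDiffOn I I.tangent ∞ (fun x => (⟨x, (V x).2.1⟩ : TangentBundle I M)) U
  bottom : ContMDiffOn I 𝓘(ℝ, ℝ) ∞ (fun x => (V x).2.2) U

/-- Parallel (smooth) tractor fields on an open set `U`; values outside `U` play no role. -/
structure IsParallelOn (g : Metric I M)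
    (P : Π x : M, TangentSpace I x →L[ℝ] TangentSpace I x →L[ℝ] ℝ)
    (V : TractorField I M) (U : Opens M) : Prop where
  smooth : IsSmoothOn V (U : Set M)
  parallel : ∀ x ∈ U, ∀ u : TangentSpace I x, tractorConnection g P V x u = 0

/-! ### Almost Einstein structures -/

/-- A directed almost Einstein structure on `(M, [g])`: a non-zero parallel tractor. -/
structure IsDirectedAE (g : Metric I M)
    (P : Π x : M, TangentSpace I x →L[ℝ] TangentSpace I x →L[ℝ] ℝ)
    (V : TractorField I M) : Prop where
  parallel : IsParallelOn g P V ⊤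
  ne_zero : V ≠ 0

/-- An almost Einstein structure on `(M, [g])`: a family of local tractor fields `(U, V)`, each of
them parallel and nowhere zero on its open set `U`, such that the sets `U` cover `M` and any two
members of the family agree on the overlap of their domains up to a sign. -/
structure IsAE (g : Metric I M)
    (P : Π x : M, TangentSpace I x →L[ℝ] TangentSpace I x →L[ℝ] ℝ)
    (A : Set (Opens M × TractorField I M)) : Prop where
  cover : ∀ x : M, ∃ a ∈ A, x ∈ a.1
  parallel : ∀ a ∈ A, IsParallelOn g P a.2 a.1
  ne_zero : ∀ a ∈ A, ∀ x ∈ a.1, a.2 x ≠ 0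
  overlap : ∀ a ∈ A, ∀ b ∈ A,
    (∀ x ∈ a.1 ⊓ b.1, a.2 x = b.2 x) ∨ (∀ x ∈ a.1 ⊓ b.1, a.2 x = - b.2 x)

/-- Linear independence of two almost Einstein structures: wherever they are both defined, their
local parallel tractors are linearly independent (this does not see the signs). -/
def AEIndependent (A B : Set (Opens M × TractorField I M)) : Prop :=
  ∀ a ∈ A, ∀ b ∈ B, ∀ x ∈ a.1 ⊓ b.1, LinearIndependent ℝ ![a.2 x, b.2 x]

/-- `(M, [g])` admits a directed almost Einstein structure. -/
def AdmitsDirectedAE (g : Metric I M)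
    (P : Π x : M, TangentSpace I x →L[ℝ] TangentSpace I x →L[ℝ] ℝ) : Prop :=
  ∃ V : TractorField I M, IsDirectedAE g P V

/-- `(M, [g])` admits at least two linearly independent directed almost Einstein structures. -/
def AdmitsTwoDirectedAE (g : Metric I M)
    (P : Π x : M, TangentSpace I x →L[ℝ] TangentSpace I x →L[ℝ] ℝ) : Prop :=
  ∃ V W : TractorField I M, IsDirectedAE g P V ∧ IsDirectedAE g P W ∧ LinearIndependent ℝ ![V, W]

/-- `(M, [g])` admits an almost Einstein structure. -/
def AdmitsAE (g : Metric I M)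
    (P : Π x : M, TangentSpace I x →L[ℝ] TangentSpace I x →L[ℝ] ℝ) : Prop :=
  ∃ A : Set (Opens M × TractorField I M), IsAE g P A

/-- `(M, [g])` admits at least two linearly independent almost Einstein structures. -/
def AdmitsTwoAE (g : Metric I M)
    (P : Π x : M, TangentSpace I x →L[ℝ] TangentSpace I x →L[ℝ] ℝ) : Prop :=
  ∃ A B : Set (Opens M × TractorField I M), IsAE g P A ∧ IsAE g P B ∧ AEIndependent A B

/-! ### Einstein manifolds of any dimension and their tractor connection -/

/-- `(M, g)` is Einstein: `Ric = Λ g` with `Λ` constant.  In dimension two this says that the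
scalar curvature is constant, in dimension one it holds for every metric. -/
def IsEinstein (g : Metric I M) : Prop :=
  ∃ Λ : ℝ, ∀ x : M, ricci g x = Λ • g.inner x

/-- The constant `c` entering the tractor connection of an Einstein manifold: in dimension `d ≥ 2`
it is `Sc / (2 d (d - 1))`, in dimension one it may be any real number. -/
def IsTractorConstant (g : Metric I M) (c : ℝ) : Prop :=
  2 ≤ Module.finrank ℝ E → ∀ x : M,
    c = scal g x / (2 * (Module.finrank ℝ E : ℝ) * ((Module.finrank ℝ E : ℝ) - 1))

/-- The Schouten tensor of an Einstein manifold with constant `c`: the usual one in dimension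
`d ≥ 3`; in dimensions one and two, where the conformal structure alone does not determine a
tractor connection, it is `c g`. -/
def einsteinSchouten (g : Metric I M) (c : ℝ) (x : M) :
    TangentSpace I x →L[ℝ] TangentSpace I x →L[ℝ] ℝ :=
  if 3 ≤ Module.finrank ℝ E then schouten g x else c • g.inner x

/-- The Einstein tractor of `g`: a parallel tractor whose scale `σ` satisfies `σ⁻² 𝐠 = g`, that is
`σ = 1` in the trivialisation given by `g`. -/
structure IsEinsteinTractor (g : Metric I M) (c : ℝ) (V : TractorField I M) : Prop where
  parallel : IsParallelOn g (einsteinSchouten g c) V ⊤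
  scale : ∀ x : M, (V x).1 = 1

end Manifold

/-! ### Products -/

section Product

variable {E₁ : Type*} [NormedAddCommGroup E₁] [NormedSpace ℝ E₁] [FiniteDimensional ℝ E₁]
  {H₁ : Type*} [TopologicalSpace H₁] {I₁ : ModelWithCorners ℝ E₁ H₁}
  {M₁ : Type*} [TopologicalSpace M₁] [ChartedSpace H₁ M₁] [IsManifold I₁ ∞ M₁]
  {E₂ : Type*} [NormedAddCommGroup E₂] [NormedSpace ℝ E₂] [FiniteDimensional ℝ E₂]
  {H₂ : Type*} [TopologicalSpace H₂] {I₂ : ModelWithCorners ℝ E₂ H₂}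
  {M₂ : Type*} [TopologicalSpace M₂] [ChartedSpace H₂ M₂] [IsManifold I₂ ∞ M₂]

/-- The bilinear form `g₁ × g₂` on `T_p (M₁ × M₂) = T_{p.1} M₁ × T_{p.2} M₂`. -/
def prodInner (g₁ : Metric I₁ M₁) (g₂ : Metric I₂ M₂) (p : M₁ × M₂) :
    TangentSpace (I₁.prod I₂) p →L[ℝ] TangentSpace (I₁.prod I₂) p →L[ℝ] ℝ :=
  let B₁ : E₁ →L[ℝ] E₁ →L[ℝ] ℝ := g₁.inner p.1
  let B₂ : E₂ →L[ℝ] E₂ →L[ℝ] ℝ := g₂.inner p.2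
  (B₁.bilinearComp (ContinuousLinearMap.fst ℝ E₁ E₂) (ContinuousLinearMap.fst ℝ E₁ E₂)
    + B₂.bilinearComp (ContinuousLinearMap.snd ℝ E₁ E₂) (ContinuousLinearMap.snd ℝ E₁ E₂) :
      (E₁ × E₂) →L[ℝ] (E₁ × E₂) →L[ℝ] ℝ)

theorem prodInner_apply (g₁ : Metric I₁ M₁) (g₂ : Metric I₂ M₂) (p : M₁ × M₂)
    (v w : TangentSpace (I₁.prod I₂) p) :
    prodInner g₁ g₂ p v w = g₁.inner p.1 v.1 w.1 + g₂.inner p.2 v.2 w.2 := rfl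

theorem tangentCoordChange_prod {p q r : M₁ × M₂}
    (hp : r ∈ (extChartAt (I₁.prod I₂) p).source) (hq : r ∈ (extChartAt (I₁.prod I₂) q).source) :
    tangentCoordChange (I₁.prod I₂) p q r =
      (tangentCoordChange I₁ p.1 q.1 r.1).prodMap (tangentCoordChange I₂ p.2 q.2 r.2) := by
  have h := hasFDerivWithinAt_tangentCoordChange (I := I₁.prod I₂) (x := p) (y := q) (z := r)
    (Set.mem_inter hp hq)
  rw [extChartAt_prod] at hp hq
  have hx : extChartAt (I₁.prod I₂) p r = (extChartAt I₁ p.1 r.1, extChartAt I₂ p.2 r.2) := by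
    simp only [extChartAt_prod, PartialEquiv.prod_coe]
  have e : ∀ a b : M₁ × M₂, (extChartAt (I₁.prod I₂) a) ∘ (extChartAt (I₁.prod I₂) b).symm =
      Prod.map (extChartAt I₁ a.1 ∘ (extChartAt I₁ b.1).symm)
        (extChartAt I₂ a.2 ∘ (extChartAt I₂ b.2).symm) := by
    intro a b
    rw [extChartAt_prod, extChartAt_prod]
    rfl
  have h₁ := hasFDerivWithinAt_tangentCoordChange (I := I₁) (x := p.1) (y := q.1) (z := r.1)
    (Set.mem_inter hp.1 hq.1)
  have h₂ := hasFDerivWithinAt_tangentCoordChange (I := I₂) (x := p.2) (y := q.2) (z := r.2)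
    (Set.mem_inter hp.2 hq.2)
  have hr : Set.range (I₁.prod I₂) = Set.range I₁ ×ˢ Set.range I₂ := ModelWithCorners.range_prod
  have h₁₂ := HasFDerivWithinAt.prodMap (s := Set.range I₁ ×ˢ Set.range I₂)
    (extChartAt I₁ p.1 r.1, extChartAt I₂ p.2 r.2)
    (h₁.mono (Set.fst_image_prod_subset _ _)) (h₂.mono (Set.snd_image_prod_subset _ _))
  have hu : UniqueDiffWithinAt ℝ (Set.range (I₁.prod I₂)) (extChartAt (I₁.prod I₂) p r) :=
    (I₁.prod I₂).uniqueDiffOn _ (Set.mem_range_self _)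
  rw [e, hx] at h
  rw [hx] at hu
  rw [hr] at h hu
  exact hu.eq h h₁₂

/-- Bilinear forms in the trivialisation of the tangent bundle given by the chart at `x₀`. -/
theorem inCoordinates_bilin_apply {E : Type*} [NormedAddCommGroup E] [NormedSpace ℝ E]
    {H : Type*} [TopologicalSpace H] {I : ModelWithCorners ℝ E H}
    {M : Type*} [TopologicalSpace M] [ChartedSpace H M] [IsManifold I ∞ M]
    {x₀ x : M} (hx : x ∈ (chartAt H x₀).source)
    (B : TangentSpace I x →L[ℝ] TangentSpace I x →L[ℝ] ℝ) (v w : E) :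
    ContinuousLinearMap.inCoordinates E (TangentSpace I) (E →L[ℝ] ℝ)
        (fun x => TangentSpace I x →L[ℝ] ℝ) x₀ x x₀ x B v w =
      B (tangentCoordChange I x₀ x x v) (tangentCoordChange I x₀ x x w) := by
  rw [inCoordinates_apply_eq₂ (E₃ := fun _ : M => ℝ) (by simpa using hx) (by simpa using hx)
    (by simp)]
  have key : ∀ v : E, (trivializationAt E (TangentSpace I) x₀).symm x v =
      tangentCoordChange I x₀ x x v := fun v =>
    (Bundle.Trivialization.symmL_apply (R := ℝ) (trivializationAt E (TangentSpace I) x₀)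
      (by simpa using hx) v).symm.trans <| congrArg (fun L : E →L[ℝ] E => L v) (TangentBundle.symmL_trivializationAt_eq_core (I := I) hx)
  rw [key, key]
  simp

theorem prodInner_contMDiff (g₁ : Metric I₁ M₁) (g₂ : Metric I₂ M₂) :
    ContMDiff (I₁.prod I₂) ((I₁.prod I₂).prod 𝓘(ℝ, (E₁ × E₂) →L[ℝ] (E₁ × E₂) →L[ℝ] ℝ)) ∞
      (fun p : M₁ × M₂ => Bundle.TotalSpace.mk' ((E₁ × E₂) →L[ℝ] (E₁ × E₂) →L[ℝ] ℝ)
        (E := fun p : M₁ × M₂ => TangentSpace (I₁.prod I₂) p →L[ℝ]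
          TangentSpace (I₁.prod I₂) p →L[ℝ] ℝ) p (prodInner g₁ g₂ p)) := by
  intro p
  rw [Bundle.contMDiffAt_section]
  simp only [hom_trivializationAt_apply]
  have h₁ := (Bundle.contMDiffAt_section _).1 (g₁.contMDiff p.1)
  have h₂ := (Bundle.contMDiffAt_section _).1 (g₂.contMDiff p.2)
  simp only [hom_trivializationAt_apply] at h₁ h₂
  have k₁ := h₁.comp p (contMDiffAt_fst (I := I₁) (J := I₂))
  have k₂ := h₂.comp p (contMDiffAt_snd (I := I₁) (J := I₂))
  have d : ContDiff ℝ ∞ (fun B : (E₁ →L[ℝ] E₁ →L[ℝ] ℝ) × (E₂ →L[ℝ] E₂ →L[ℝ] ℝ) =>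
      (B.1.bilinearComp (ContinuousLinearMap.fst ℝ E₁ E₂) (ContinuousLinearMap.fst ℝ E₁ E₂)
        + B.2.bilinearComp (ContinuousLinearMap.snd ℝ E₁ E₂) (ContinuousLinearMap.snd ℝ E₁ E₂) :
          (E₁ × E₂) →L[ℝ] (E₁ × E₂) →L[ℝ] ℝ)) := by
    have f : ContDiff ℝ ∞ (fun L : E₁ × E₂ →L[ℝ] E₁ →L[ℝ] ℝ => L.flip) :=
      (ContinuousLinearMap.flipₗᵢ ℝ (E₁ × E₂) E₁ ℝ).contDiff
    have f' : ContDiff ℝ ∞ (fun L : E₁ × E₂ →L[ℝ] E₁ × E₂ →L[ℝ] ℝ => L.flip) :=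
      (ContinuousLinearMap.flipₗᵢ ℝ (E₁ × E₂) (E₁ × E₂) ℝ).contDiff
    have k : ContDiff ℝ ∞ (fun L : E₁ × E₂ →L[ℝ] E₂ →L[ℝ] ℝ => L.flip) :=
      (ContinuousLinearMap.flipₗᵢ ℝ (E₁ × E₂) E₂ ℝ).contDiff
    have a₁ : ContDiff ℝ ∞ (fun B : (E₁ →L[ℝ] E₁ →L[ℝ] ℝ) × (E₂ →L[ℝ] E₂ →L[ℝ] ℝ) =>
        B.1 ∘L ContinuousLinearMap.fst ℝ E₁ E₂) := contDiff_fst.clm_comp contDiff_const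
    have a₂ : ContDiff ℝ ∞ (fun B : (E₁ →L[ℝ] E₁ →L[ℝ] ℝ) × (E₂ →L[ℝ] E₂ →L[ℝ] ℝ) =>
        B.2 ∘L ContinuousLinearMap.snd ℝ E₁ E₂) := contDiff_snd.clm_comp contDiff_const
    have b₁ : ContDiff ℝ ∞ (fun B : (E₁ →L[ℝ] E₁ →L[ℝ] ℝ) × (E₂ →L[ℝ] E₂ →L[ℝ] ℝ) =>
        (B.1 ∘L ContinuousLinearMap.fst ℝ E₁ E₂).flip ∘L ContinuousLinearMap.fst ℝ E₁ E₂) :=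
      (f.comp a₁).clm_comp contDiff_const
    have b₂ : ContDiff ℝ ∞ (fun B : (E₁ →L[ℝ] E₁ →L[ℝ] ℝ) × (E₂ →L[ℝ] E₂ →L[ℝ] ℝ) =>
        (B.2 ∘L ContinuousLinearMap.snd ℝ E₁ E₂).flip ∘L ContinuousLinearMap.snd ℝ E₁ E₂) :=
      (k.comp a₂).clm_comp contDiff_const
    exact (f'.comp b₁).add (f'.comp b₂)
  refine (d.contMDiff.contMDiffAt.comp p (k₁.prodMk_space k₂)).congr_of_eventuallyEq ?_
  filter_upwards [(chartAt (ModelProd H₁ H₂) p).open_source.mem_nhds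
    (mem_chart_source (ModelProd H₁ H₂) p)] with q hq
  have hq' : q ∈ (chartAt H₁ p.1).source ×ˢ (chartAt H₂ p.2).source := hq
  refine ContinuousLinearMap.ext fun v => ContinuousLinearMap.ext fun w => ?_
  have e : tangentCoordChange (I₁.prod I₂) p q q =
      (tangentCoordChange I₁ p.1 q.1 q.1).prodMap (tangentCoordChange I₂ p.2 q.2 q.2) :=
    tangentCoordChange_prod (by rw [extChartAt_source]; exact hq) (mem_extChartAt_source q)
  refine (inCoordinates_bilin_apply hq (prodInner g₁ g₂ q) v w).trans ?_
  rw [e]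
  exact (congrArg₂ (· + ·) (inCoordinates_bilin_apply hq'.1 (g₁.inner q.1) v.1 w.1)
    (inCoordinates_bilin_apply hq'.2 (g₂.inner q.2) v.2 w.2)).symm

/-- The product metric `g₁ × g₂`. -/
def prodMetric (g₁ : Metric I₁ M₁) (g₂ : Metric I₂ M₂) : Metric (I₁.prod I₂) (M₁ × M₂) where
  inner := prodInner g₁ g₂
  symm p v w := by
    exact congrArg₂ (· + ·) (g₁.symm p.1 v.1 w.1) (g₂.symm p.2 v.2 w.2)
  pos p v hv := by
    rw [prodInner_apply]
    have n₁ : ∀ u : TangentSpace I₁ p.1, 0 ≤ g₁.inner p.1 u u := fun u => by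
      by_cases hu : u = 0
      · simp [hu]
      · exact (g₁.pos p.1 u hu).le
    have n₂ : ∀ u : TangentSpace I₂ p.2, 0 ≤ g₂.inner p.2 u u := fun u => by
      by_cases hu : u = 0
      · simp [hu]
      · exact (g₂.pos p.2 u hu).le
    by_cases h : v.1 = 0
    · exact add_pos_of_nonneg_of_pos (n₁ _)
        (g₂.pos p.2 v.2 fun h' => hv (Prod.ext h h'))
    · exact add_pos_of_pos_of_nonneg (g₁.pos p.1 v.1 h) (n₂ _)
  isVonNBounded p := by
    have n₁ : ∀ u : TangentSpace I₁ p.1, 0 ≤ g₁.inner p.1 u u := fun u => by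
      by_cases hu : u = 0
      · simp [hu]
      · exact (g₁.pos p.1 u hu).le
    have n₂ : ∀ u : TangentSpace I₂ p.2, 0 ≤ g₂.inner p.2 u u := fun u => by
      by_cases hu : u = 0
      · simp [hu]
      · exact (g₂.pos p.2 u hu).le
    have b₁ : Bornology.IsBounded {v : E₁ | g₁.inner p.1 v v < 1} :=
      (NormedSpace.isVonNBounded_iff ℝ (E := E₁)).1 (g₁.isVonNBounded p.1)
    have b₂ : Bornology.IsBounded {v : E₂ | g₂.inner p.2 v v < 1} :=
      (NormedSpace.isVonNBounded_iff ℝ (E := E₂)).1 (g₂.isVonNBounded p.2)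
    have b : Bornology.IsBounded {v : E₁ × E₂ | prodInner g₁ g₂ p v v < 1} := by
      refine (b₁.prod b₂).subset fun v hv => ⟨?_, ?_⟩
      · exact lt_of_le_of_lt (le_add_of_nonneg_right (n₂ v.2)) hv
      · exact lt_of_le_of_lt (le_add_of_nonneg_left (n₁ v.1)) hv
    exact (NormedSpace.isVonNBounded_iff ℝ (E := E₁ × E₂)).2 b
  contMDiff := prodInner_contMDiff g₁ g₂

/-- Special Einstein products: `(M_i, g_i)` is Einstein (with tractor constant `c_i`) with Einstein
tractor `J_i`, and `|J₁|² = -|J₂|² ≠ 0`. -/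
structure IsSpecialEinsteinProduct (g₁ : Metric I₁ M₁) (c₁ : ℝ) (g₂ : Metric I₂ M₂) (c₂ : ℝ)
    (J₁ : TractorField I₁ M₁) (J₂ : TractorField I₂ M₂) : Prop where
  dim₁ : 1 ≤ Module.finrank ℝ E₁
  dim₂ : 1 ≤ Module.finrank ℝ E₂
  dim : 3 ≤ Module.finrank ℝ E₁ + Module.finrank ℝ E₂
  einstein₁ : IsEinstein g₁
  einstein₂ : IsEinstein g₂
  constant₁ : IsTractorConstant g₁ c₁
  constant₂ : IsTractorConstant g₂ c₂
  tractor₁ : IsEinsteinTractor g₁ c₁ J₁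
  tractor₂ : IsEinsteinTractor g₂ c₂ J₂
  norm_eq : ∀ (x : M₁) (y : M₂),
    tractorNormSq g₁ x (J₁ x) = - tractorNormSq g₂ y (J₂ y)
  norm_ne : ∀ x : M₁, tractorNormSq g₁ x (J₁ x) ≠ 0

end Product

end ConformalTractor


end

open ConformalTractor

/-! Write `c` for `c₁`. The Schouten tensor of each factor is `cᵢ gᵢ` and its Einstein tractor is
`(1, 0, -cᵢ)`, of squared norm `-2 cᵢ`; so the product is special exactly when `c₂ = -c₁ ≠ 0`. For
such constants the Schouten tensor of the product metric is `c g₁ - c g₂` (`schouten_prod`).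

With this Schouten tensor the standard tractor bundle of the product is the direct sum of the
orthogonal complements of the two Einstein tractors, compatibly with the connections. For `(σ, (μ₁,
μ₂), ρ)` put `a = ρ + c₁ σ` and `b = ρ + c₂ σ`: the two components are `(a / (2 c₁), μ₁, a / 2)` and
`(b / (2 c₂), μ₂, b / 2)`. If the tractor is parallel, the first component is parallel along every
slice `M₁ × {y}` and the second along every `{x} × M₂` (`isParallelOn_slice_fst`,
`isParallelOn_slice_snd`). Conversely, a parallel tractor of a factor orthogonal to the Einstein
tractor lifts to a parallel tractor of the product (`isParallelOn_liftFst`, `isParallelOn_liftSnd`).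
On a factor, having two independent structures amounts to having one that is orthogonal to the
Einstein tractor.

In the directed case a component that is non-zero at one point is enough. In the case up to sign a
component must be nowhere zero on a whole slice. Its squared norm does not see signs and is constant
on slices; if it is non-zero on some slice, that slice serves. If the norms of both components
vanish on all slices, one of `c₁`, `c₂` is positive, and the tractor metric is definite on the
corresponding complement. That component then vanishes identically, so the other has no zeros
(`exists_slice_ne_zero`). -/

noncomputable section

namespace ConformalTractor

/-! ### Block diagonal metrics on a product of vector spaces -/

section Block

variable {E E₁ E₂ : Type*} [NormedAddCommGroup E] [NormedSpace ℝ E] [FiniteDimensional ℝ E]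
  [NormedAddCommGroup E₁] [NormedSpace ℝ E₁] [FiniteDimensional ℝ E₁]
  [NormedAddCommGroup E₂] [NormedSpace ℝ E₂] [FiniteDimensional ℝ E₂]

/-- A bilinear form which is positive on the diagonal is nondegenerate. -/
theorem isInvertible_of_pos {B : E →L[ℝ] E →L[ℝ] ℝ} (h : ∀ v, v ≠ 0 → 0 < B v v) :
    B.IsInvertible := by
  have inj : Function.Injective (B : E →ₗ[ℝ] E →L[ℝ] ℝ) := by
    rw [← LinearMap.ker_eq_bot, LinearMap.ker_eq_bot']
    intro v hv
    by_contra hne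
    have hv' : B v = 0 := hv
    have := h v hne
    simp [hv'] at this
  have dim : Module.finrank ℝ E = Module.finrank ℝ (E →L[ℝ] ℝ) := by
    rw [← (LinearMap.toContinuousLinearMap (𝕜 := ℝ) (E := E) (F' := ℝ)).finrank_eq]
    exact (Subspace.dual_finrank_eq (K := ℝ) (V := E)).symm
  refine ⟨(LinearMap.linearEquivOfInjective _ inj dim).toContinuousLinearEquiv, ?_⟩
  ext v w
  rfl

/-- The block diagonal sum of two bilinear forms. -/
def blockForm (B₁ : E₁ →L[ℝ] E₁ →L[ℝ] ℝ) (B₂ : E₂ →L[ℝ] E₂ →L[ℝ] ℝ) :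
    (E₁ × E₂) →L[ℝ] (E₁ × E₂) →L[ℝ] ℝ :=
  B₁.bilinearComp (ContinuousLinearMap.fst ℝ E₁ E₂) (ContinuousLinearMap.fst ℝ E₁ E₂)
    + B₂.bilinearComp (ContinuousLinearMap.snd ℝ E₁ E₂) (ContinuousLinearMap.snd ℝ E₁ E₂)

theorem blockForm_apply (B₁ : E₁ →L[ℝ] E₁ →L[ℝ] ℝ) (B₂ : E₂ →L[ℝ] E₂ →L[ℝ] ℝ) (v w : E₁ × E₂) :
    blockForm B₁ B₂ v w = B₁ v.1 w.1 + B₂ v.2 w.2 := rfl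

/-- The map `C` built from the two inverses is a two-sided inverse. Both conclusions come from it,
since `ContinuousLinearMap.inverse` is meaningful only on invertible maps. -/
theorem blockForm_inverse_aux {B₁ : E₁ →L[ℝ] E₁ →L[ℝ] ℝ} {B₂ : E₂ →L[ℝ] E₂ →L[ℝ] ℝ}
    (h₁ : B₁.IsInvertible) (h₂ : B₂.IsInvertible) :
    (blockForm B₁ B₂).IsInvertible ∧ ∀ l, (blockForm B₁ B₂).inverse l =
      (B₁.inverse (l ∘L ContinuousLinearMap.inl ℝ E₁ E₂),
        B₂.inverse (l ∘L ContinuousLinearMap.inr ℝ E₁ E₂)) := by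
  let C : ((E₁ × E₂) →L[ℝ] ℝ) →L[ℝ] E₁ × E₂ :=
    LinearMap.toContinuousLinearMap
      { toFun := fun l => (B₁.inverse (l ∘L ContinuousLinearMap.inl ℝ E₁ E₂),
          B₂.inverse (l ∘L ContinuousLinearMap.inr ℝ E₁ E₂))
        map_add' := fun l l' => by simp [ContinuousLinearMap.add_comp]
        map_smul' := fun c l => by simp [ContinuousLinearMap.smul_comp] }
  have hC : ∀ l, C l = (B₁.inverse (l ∘L ContinuousLinearMap.inl ℝ E₁ E₂),
        B₂.inverse (l ∘L ContinuousLinearMap.inr ℝ E₁ E₂)) := fun l => rfl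
  have right : blockForm B₁ B₂ ∘L C = .id ℝ _ := by
    refine ContinuousLinearMap.ext fun l => ContinuousLinearMap.ext fun v => ?_
    rw [ContinuousLinearMap.comp_apply, blockForm_apply, hC]
    simp only [h₁.self_apply_inverse, h₂.self_apply_inverse, ContinuousLinearMap.comp_apply,
      ContinuousLinearMap.id_apply, ContinuousLinearMap.inl_apply, ContinuousLinearMap.inr_apply]
    rw [← map_add]
    simp
  have left : C ∘L blockForm B₁ B₂ = .id ℝ _ := by
    refine ContinuousLinearMap.ext fun v => ?_
    rw [ContinuousLinearMap.comp_apply, hC]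
    have e₁ : (blockForm B₁ B₂ v) ∘L ContinuousLinearMap.inl ℝ E₁ E₂ = B₁ v.1 := by
      ext w; simp [blockForm_apply]
    have e₂ : (blockForm B₁ B₂ v) ∘L ContinuousLinearMap.inr ℝ E₁ E₂ = B₂ v.2 := by
      ext w; simp [blockForm_apply]
    rw [e₁, e₂, h₁.inverse_apply_self, h₂.inverse_apply_self]
    rfl
  exact ⟨.of_inverse right left, fun l => by rw [ContinuousLinearMap.inverse_eq right left, hC]⟩

theorem blockForm_inverse_apply {B₁ : E₁ →L[ℝ] E₁ →L[ℝ] ℝ} {B₂ : E₂ →L[ℝ] E₂ →L[ℝ] ℝ}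
    (h₁ : B₁.IsInvertible) (h₂ : B₂.IsInvertible) (l : (E₁ × E₂) →L[ℝ] ℝ) :
    (blockForm B₁ B₂).inverse l =
      (B₁.inverse (l ∘L ContinuousLinearMap.inl ℝ E₁ E₂),
        B₂.inverse (l ∘L ContinuousLinearMap.inr ℝ E₁ E₂)) :=
  (blockForm_inverse_aux h₁ h₂).2 l

theorem fderiv_fun_apply₂ {V F : Type*} [NormedAddCommGroup V] [NormedSpace ℝ V]
    [NormedAddCommGroup F] [NormedSpace ℝ F] {G : V → E →L[ℝ] E →L[ℝ] F} {y : V}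
    (hG : DifferentiableAt ℝ G y) (u : V) (v w : E) :
    fderiv ℝ (fun z => G z v w) y u = fderiv ℝ G y u v w := by
  have h := ((hG.hasFDerivAt.clm_apply (hasFDerivAt_const v y)).clm_apply
    (hasFDerivAt_const w y)).fderiv
  rw [h]
  simp

theorem differentiableAt_bilinearComp_const {V E F : Type*} [NormedAddCommGroup V] [NormedSpace ℝ V]
    [NormedAddCommGroup E] [NormedSpace ℝ E] [NormedAddCommGroup F] [NormedSpace ℝ F]
    {G : V → E →L[ℝ] E →L[ℝ] ℝ} {y : V} (hG : DifferentiableAt ℝ G y) (A : F →L[ℝ] E) :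
    DifferentiableAt ℝ (fun z => (G z).bilinearComp A A) y := by
  have a : DifferentiableAt ℝ (fun z => (G z) ∘L A) y := hG.clm_comp (differentiableAt_const A)
  have b : DifferentiableAt ℝ (fun z => ((G z) ∘L A).flip ∘L A) y :=
    ((ContinuousLinearMap.flipₗᵢ ℝ F E ℝ).differentiableAt.comp y a).clm_comp
      (differentiableAt_const A)
  exact (ContinuousLinearMap.flipₗᵢ ℝ F F ℝ).differentiableAt.comp y b

theorem differentiableAt_blockForm {V : Type*} [NormedAddCommGroup V] [NormedSpace ℝ V]
    {G₁ : V → E₁ →L[ℝ] E₁ →L[ℝ] ℝ} {G₂ : V → E₂ →L[ℝ] E₂ →L[ℝ] ℝ} {y : V}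
    (h₁ : DifferentiableAt ℝ G₁ y) (h₂ : DifferentiableAt ℝ G₂ y) :
    DifferentiableAt ℝ (fun z => blockForm (G₁ z) (G₂ z)) y :=
  (differentiableAt_bilinearComp_const h₁ _).add (differentiableAt_bilinearComp_const h₂ _)

/-- Each block depends on its own variable only, so there are no mixed derivatives. This is the
source of the splitting of the Koszul expression, the Christoffel symbols and the curvature. -/
theorem fderiv_blockForm {G₁ : E₁ → E₁ →L[ℝ] E₁ →L[ℝ] ℝ} {G₂ : E₂ → E₂ →L[ℝ] E₂ →L[ℝ] ℝ}
    {y : E₁ × E₂} (h₁ : DifferentiableAt ℝ G₁ y.1) (h₂ : DifferentiableAt ℝ G₂ y.2)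
    (u v w : E₁ × E₂) :
    fderiv ℝ (fun z : E₁ × E₂ => blockForm (G₁ z.1) (G₂ z.2)) y u v w =
      fderiv ℝ G₁ y.1 u.1 v.1 w.1 + fderiv ℝ G₂ y.2 u.2 v.2 w.2 := by
  have k₁ : DifferentiableAt ℝ (fun z : E₁ × E₂ => G₁ z.1) y := h₁.comp y differentiableAt_fst
  have k₂ : DifferentiableAt ℝ (fun z : E₁ × E₂ => G₂ z.2) y := h₂.comp y differentiableAt_snd
  rw [← fderiv_fun_apply₂ (differentiableAt_blockForm k₁ k₂)]
  simp only [blockForm_apply]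
  have e₁ := (((h₁.hasFDerivAt.comp y hasFDerivAt_fst).clm_apply
    (hasFDerivAt_const v.1 y)).clm_apply (hasFDerivAt_const w.1 y))
  have e₂ := (((h₂.hasFDerivAt.comp y hasFDerivAt_snd).clm_apply
    (hasFDerivAt_const v.2 y)).clm_apply (hasFDerivAt_const w.2 y))
  refine (congrArg (fun L : E₁ × E₂ →L[ℝ] ℝ => L u) (e₁.add e₂).fderiv).trans ?_
  simp

theorem koszul_blockForm {G₁ : E₁ → E₁ →L[ℝ] E₁ →L[ℝ] ℝ} {G₂ : E₂ → E₂ →L[ℝ] E₂ →L[ℝ] ℝ}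
    {y : E₁ × E₂} (h₁ : DifferentiableAt ℝ G₁ y.1) (h₂ : DifferentiableAt ℝ G₂ y.2)
    (u v w : E₁ × E₂) :
    koszul (fun z : E₁ × E₂ => blockForm (G₁ z.1) (G₂ z.2)) y u v w =
      koszul G₁ y.1 u.1 v.1 w.1 + koszul G₂ y.2 u.2 v.2 w.2 := by
  simp only [koszul_apply, fderiv_blockForm h₁ h₂]
  ring

theorem christoffel_blockForm {G₁ : E₁ → E₁ →L[ℝ] E₁ →L[ℝ] ℝ} {G₂ : E₂ → E₂ →L[ℝ] E₂ →L[ℝ] ℝ}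
    {y : E₁ × E₂} (h₁ : DifferentiableAt ℝ G₁ y.1) (h₂ : DifferentiableAt ℝ G₂ y.2)
    (i₁ : (G₁ y.1).IsInvertible) (i₂ : (G₂ y.2).IsInvertible) (u v : E₁ × E₂) :
    christoffel (fun z : E₁ × E₂ => blockForm (G₁ z.1) (G₂ z.2)) y u v =
      (christoffel G₁ y.1 u.1 v.1, christoffel G₂ y.2 u.2 v.2) := by
  rw [christoffel_apply, blockForm_inverse_apply i₁ i₂, christoffel_apply, christoffel_apply]
  congr 2 <;> ext w <;> simp [koszul_blockForm h₁ h₂]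

theorem koszul_congr {G G' : E → E →L[ℝ] E →L[ℝ] ℝ} {y : E} (h : G =ᶠ[𝓝 y] G') :
    koszul G y = koszul G' y := by
  simp only [koszul, h.fderiv_eq]

theorem christoffel_congr {G G' : E → E →L[ℝ] E →L[ℝ] ℝ} {y : E} (h : G =ᶠ[𝓝 y] G') :
    christoffel G y = christoffel G' y := by
  simp only [christoffel, koszul_congr h, h.eq_of_nhds]

/-- The Christoffel symbols contain one derivative of `G` and the curvature takes another, hence the
`C²` assumption; inversion is smooth at invertible maps. -/
theorem differentiableAt_christoffel {G : E → E →L[ℝ] E →L[ℝ] ℝ} {y : E}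
    (hG : ContDiffAt ℝ 2 G y) (hi : (G y).IsInvertible) :
    DifferentiableAt ℝ (christoffel G) y := by
  have hD : DifferentiableAt ℝ (fderiv ℝ G) y :=
    (hG.fderiv_right (m := 1) (by norm_num)).differentiableAt (by norm_num)
  have hI : DifferentiableAt ℝ (fun z => (G z).inverse) y :=
    ((hi.contDiffAt_map_inverse (n := 1)).differentiableAt (by norm_num)).comp y
      (hG.differentiableAt (by norm_num))
  have hK : DifferentiableAt ℝ (koszul G) y := by
    -- The Koszul expression is a fixed linear function `Λ` of the derivative of `G`.
    let Λ : (E →L[ℝ] E →L[ℝ] E →L[ℝ] ℝ) →L[ℝ] (E →L[ℝ] E →L[ℝ] E →L[ℝ] ℝ) :=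
      LinearMap.toContinuousLinearMap
        { toFun := fun D => (1 / 2 : ℝ) • (D + D.flip -
            ((ContinuousLinearMap.flipₗᵢ ℝ E E ℝ).toContinuousLinearEquiv :
              (E →L[ℝ] E →L[ℝ] ℝ) →L[ℝ] (E →L[ℝ] E →L[ℝ] ℝ)) ∘L D.flip)
          map_add' := fun D D' => by ext; simp; ring
          map_smul' := fun c D => by ext; simp; ring }
    exact Λ.differentiableAt.comp y hD
  exact (((ContinuousLinearMap.compL ℝ E (E →L[ℝ] ℝ) E).differentiableAt.comp y hI).clm_comp hK)

/-- Curvature is a derivative of `Γ` plus terms quadratic in `Γ`, and both split. Because of the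
derivative the splitting of `Γ` has to hold on a neighbourhood, not just at `y`. -/
theorem curvature_block {Γ₁ : E₁ → E₁ →L[ℝ] E₁ →L[ℝ] E₁} {Γ₂ : E₂ → E₂ →L[ℝ] E₂ →L[ℝ] E₂}
    {Γ : E₁ × E₂ → (E₁ × E₂) →L[ℝ] (E₁ × E₂) →L[ℝ] (E₁ × E₂)} {y : E₁ × E₂}
    (h : DifferentiableAt ℝ Γ y)
    (h₁ : DifferentiableAt ℝ Γ₁ y.1) (h₂ : DifferentiableAt ℝ Γ₂ y.2)
    (hΓ : ∀ᶠ z in 𝓝 y, ∀ u v, Γ z u v = (Γ₁ z.1 u.1 v.1, Γ₂ z.2 u.2 v.2)) (v w : E₁ × E₂) :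
    curvature Γ y v w =
      (curvature Γ₁ y.1 v.1 w.1).prodMap (curvature Γ₂ y.2 v.2 w.2) := by
  have D : ∀ u v w, fderiv ℝ Γ y u v w =
      (fderiv ℝ Γ₁ y.1 u.1 v.1 w.1, fderiv ℝ Γ₂ y.2 u.2 v.2 w.2) := by
    intro u v w
    rw [← fderiv_fun_apply₂ h]
    have ev : (fun z => Γ z v w) =ᶠ[𝓝 y] fun z => (Γ₁ z.1 v.1 w.1, Γ₂ z.2 v.2 w.2) := by
      filter_upwards [hΓ] with z hz using hz v w
    rw [ev.fderiv_eq]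
    have e₁ := (((h₁.hasFDerivAt.comp y hasFDerivAt_fst).clm_apply
      (hasFDerivAt_const v.1 y)).clm_apply (hasFDerivAt_const w.1 y))
    have e₂ := (((h₂.hasFDerivAt.comp y hasFDerivAt_snd).clm_apply
      (hasFDerivAt_const v.2 y)).clm_apply (hasFDerivAt_const w.2 y))
    refine (congrArg (fun L : E₁ × E₂ →L[ℝ] E₁ × E₂ => L u) (e₁.prodMk e₂).fderiv).trans ?_
    simp
  have hy := hΓ.self_of_nhds
  refine ContinuousLinearMap.ext fun u => ?_
  rw [curvature_apply]
  simp only [D, hy]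
  rfl

theorem chartRicci_block {Γ₁ : E₁ → E₁ →L[ℝ] E₁ →L[ℝ] E₁} {Γ₂ : E₂ → E₂ →L[ℝ] E₂ →L[ℝ] E₂}
    {Γ : E₁ × E₂ → (E₁ × E₂) →L[ℝ] (E₁ × E₂) →L[ℝ] (E₁ × E₂)} {y : E₁ × E₂}
    (h : DifferentiableAt ℝ Γ y)
    (h₁ : DifferentiableAt ℝ Γ₁ y.1) (h₂ : DifferentiableAt ℝ Γ₂ y.2)
    (hΓ : ∀ᶠ z in 𝓝 y, ∀ u v, Γ z u v = (Γ₁ z.1 u.1 v.1, Γ₂ z.2 u.2 v.2)) :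
    chartRicci Γ y = blockForm (chartRicci Γ₁ y.1) (chartRicci Γ₂ y.2) := by
  refine ContinuousLinearMap.ext fun v => ContinuousLinearMap.ext fun w => ?_
  rw [blockForm_apply, chartRicci_apply, chartRicci_apply, chartRicci_apply,
    curvature_block h h₁ h₂ hΓ]
  exact LinearMap.trace_prodMap' _ _

/-- A linear connection on a line is flat. -/
theorem chartRicci_eq_zero_of_finrank_eq_one (Γ : E → E →L[ℝ] E →L[ℝ] E) (y : E)
    (h : Module.finrank ℝ E = 1) : chartRicci Γ y = 0 := by
  obtain ⟨e, -, he⟩ := finrank_eq_one_iff'.1 h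
  ext v w
  rw [chartRicci_apply]
  -- The curvature is antisymmetric in `u` and `v`, and on a line both are multiples of the same
  -- vector `e`.
  have : curvature Γ y v w = 0 := by
    ext u
    obtain ⟨a, rfl⟩ := he u
    obtain ⟨b, rfl⟩ := he v
    rw [curvature_apply]
    simp only [map_smul, smul_apply, smul_comm a b]
    simp
  simp [this]

/-- The Levi-Civita connection in a chart is metric. -/
theorem apply_christoffel_self {G : E → E →L[ℝ] E →L[ℝ] ℝ} {y : E} (hi : (G y).IsInvertible)
    (u v : E) : G y (christoffel G y u v) v = (1 / 2) * fderiv ℝ G y u v v := by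
  rw [christoffel_apply, hi.self_apply_inverse, koszul_apply]
  ring

end Block

/-! ### The Levi-Civita connection in the preferred chart -/

section Chart

variable {E : Type*} [NormedAddCommGroup E] [NormedSpace ℝ E] [FiniteDimensional ℝ E]

section Model

/-- The covariant derivative of a vector field `T` on `E` for the Levi-Civita connection of `G`. -/
def modelCovDeriv (G : E → E →L[ℝ] E →L[ℝ] ℝ) (T : E → E) (y : E) : E →L[ℝ] E :=
  fderiv ℝ T y + (christoffel G y).flip (T y)

theorem modelCovDeriv_apply (G : E → E →L[ℝ] E →L[ℝ] ℝ) (T : E → E) (y u : E) :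
    modelCovDeriv G T y u = fderiv ℝ T y u + christoffel G y u (T y) := rfl

theorem modelCovDeriv_zero (G : E → E →L[ℝ] E →L[ℝ] ℝ) (y : E) :
    modelCovDeriv G (fun _ => 0) y = 0 := by
  ext u
  simp [modelCovDeriv_apply]

theorem modelCovDeriv_sub (G : E → E →L[ℝ] E →L[ℝ] ℝ) {S T : E → E} {y : E}
    (hS : DifferentiableAt ℝ S y) (hT : DifferentiableAt ℝ T y) (u : E) :
    modelCovDeriv G (fun z => S z - T z) y u = modelCovDeriv G S y u - modelCovDeriv G T y u := by
  simp only [modelCovDeriv_apply, fderiv_fun_sub hS hT, map_sub, sub_apply]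
  abel

theorem modelCovDeriv_smul (G : E → E →L[ℝ] E →L[ℝ] ℝ) {f : E → ℝ} {T : E → E} {y : E}
    (hf : DifferentiableAt ℝ f y) (hT : DifferentiableAt ℝ T y) (u : E) :
    modelCovDeriv G (fun z => f z • T z) y u =
      fderiv ℝ f y u • T y + f y • modelCovDeriv G T y u := by
  simp only [modelCovDeriv_apply, fderiv_fun_smul hf hT, map_smul, add_apply, smul_apply, smul_add,
    ContinuousLinearMap.smulRight_apply]
  abel

/-- The product rule gives `D_u G (T, T) + 2 G (D_u T, T)`, and by `apply_christoffel_self` the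
Christoffel term in `2 G (∇_u T, T)` is exactly `D_u G (T, T)`. -/
theorem fderiv_apply_modelCovDeriv {G : E → E →L[ℝ] E →L[ℝ] ℝ} {T : E → E} {y : E}
    (hG : DifferentiableAt ℝ G y) (hi : (G y).IsInvertible) (hs : ∀ z v w, G z v w = G z w v)
    (hT : DifferentiableAt ℝ T y) (u : E) :
    fderiv ℝ (fun z => G z (T z) (T z)) y u = 2 * G y (modelCovDeriv G T y u) (T y) := by
  have h := ((hG.hasFDerivAt.clm_apply hT.hasFDerivAt).clm_apply hT.hasFDerivAt).fderiv
  have c := apply_christoffel_self hi u (T y)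
  have s := hs y (T y) (fderiv ℝ T y u)
  rw [h, modelCovDeriv_apply, map_add]
  simp only [add_apply, ContinuousLinearMap.comp_apply, ContinuousLinearMap.flip_apply]
  linarith

end Model

variable {H : Type*} [TopologicalSpace H] {I : ModelWithCorners ℝ E H} [I.Boundaryless]
  {M : Type*} [TopologicalSpace M] [ChartedSpace H M] [IsManifold I ∞ M]

variable (I) in
/-- The differential of the inverse of the preferred chart at `x`. -/
def chartFrame (x : M) (y : E) : E →L[ℝ] E :=
  mfderiv 𝓘(ℝ, E) I (extChartAt I x).symm y

/-- The vector field `t` in the preferred chart at `x`. -/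
def chartField (t : Π x : M, TangentSpace I x) (x : M) : E → E :=
  VectorField.mpullback 𝓘(ℝ, E) I (extChartAt I x).symm t

theorem chartField_apply (t : Π x : M, TangentSpace I x) (x : M) (y : E) :
    chartField t x y = (chartFrame I x y).inverse (t ((extChartAt I x).symm y)) := rfl

theorem chartMetric_apply (g : Metric I M) (x : M) (y v w : E) :
    chartMetric g x y v w =
      g.inner ((extChartAt I x).symm y) (chartFrame I x y v) (chartFrame I x y w) := rfl

theorem isInvertible_chartFrame (x : M) {y : E} (hy : y ∈ (extChartAt I x).target) :
    (chartFrame I x y).IsInvertible := by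
  have : IsManifold I 1 M := .of_le (n := ∞) (by norm_cast)
  have h := isInvertible_mfderivWithin_extChartAt_symm (I := I) hy
  rw [I.range_eq_univ, mfderivWithin_univ] at h
  exact h

/-- Tangent vectors at `x` are identified with `E` through the preferred chart at `x`. Hence
`covDeriv` and `ricci`, which are computed in the chart at the point itself, compare with tensors on
`M` without a change of frame. -/
theorem chartFrame_self (x : M) :
    chartFrame I x (extChartAt I x x) = ContinuousLinearMap.id ℝ E := by
  have : IsManifold I 1 M := .of_le (n := ∞) (by norm_cast)
  have h := mfderivWithin_range_extChartAt_symm (I := I) (x := x)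
  rw [I.range_eq_univ, mfderivWithin_univ] at h
  exact h

theorem chartField_self (t : Π x : M, TangentSpace I x) (x : M) :
    chartField t x (extChartAt I x x) = t x := by
  rw [chartField_apply, chartFrame_self, ContinuousLinearMap.inverse_id]
  exact congrArg (fun z => (t z : E)) (extChartAt_to_inv (I := I) x)

theorem chartMetric_self (g : Metric I M) (x : M) :
    chartMetric g x (extChartAt I x x) = (g.inner x : E →L[ℝ] E →L[ℝ] ℝ) := by
  refine ContinuousLinearMap.ext fun v => ContinuousLinearMap.ext fun w => ?_
  rw [chartMetric_apply, chartFrame_self]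
  exact congrArg (fun z => (g.inner z : E →L[ℝ] E →L[ℝ] ℝ) v w) (extChartAt_to_inv (I := I) x)

theorem isInvertible_inner (g : Metric I M) (x : M) :
    (g.inner x : E →L[ℝ] E →L[ℝ] ℝ).IsInvertible :=
  isInvertible_of_pos (E := E) fun v hv => g.pos x v hv

theorem isInvertible_chartMetric (g : Metric I M) (x : M) {y : E}
    (hy : y ∈ (extChartAt I x).target) : (chartMetric g x y).IsInvertible := by
  refine isInvertible_of_pos fun v hv => ?_
  rw [chartMetric_apply]
  refine g.pos _ _ fun h0 => hv ((isInvertible_chartFrame x hy).injective ?_)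
  rw [map_zero]
  exact h0

theorem target_mem_nhds (x : M) {y : E} (hy : y ∈ (extChartAt I x).target) :
    (extChartAt I x).target ∈ 𝓝 y :=
  (isOpen_extChartAt_target x).mem_nhds hy

/-- Smoothness of `g` is given in the trivialisation of the bundle of bilinear forms at `x`; on the
chart domain the representative of `g` there is `chartMetric g x`. -/
theorem contDiffAt_chartMetric (g : Metric I M) (x : M) {y : E}
    (hy : y ∈ (extChartAt I x).target) : ContDiffAt ℝ ∞ (chartMetric g x) y := by
  have : IsManifold I 1 M := .of_le (n := ∞) (by norm_cast)
  have hs : ContMDiffAt 𝓘(ℝ, E) I ∞ (extChartAt I x).symm y :=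
    (contMDiffOn_extChartAt_symm x).contMDiffAt (target_mem_nhds x hy)
  have hx : (extChartAt I x).symm y ∈ (chartAt H x).source := by
    rw [← extChartAt_source (I := I)]
    exact (extChartAt I x).map_target hy
  have hg := (Bundle.Trivialization.contMDiffAt_section_iff (IB := I) (n := ∞)
    (trivializationAt (E →L[ℝ] E →L[ℝ] ℝ) (fun x : M => TangentSpace I x →L[ℝ] TangentSpace I x →L[ℝ] ℝ) x)
    (s := g.inner) (x₀ := (extChartAt I x).symm y) (by simpa using hx)).1 (g.contMDiff _)
  simp only [hom_trivializationAt_apply] at hg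
  have hc := contMDiffAt_iff_contDiffAt.1 (hg.comp y hs)
  refine hc.congr_of_eventuallyEq ?_
  filter_upwards [target_mem_nhds x hy] with z hz
  refine ContinuousLinearMap.ext fun v => ContinuousLinearMap.ext fun w => ?_
  have hzx : (extChartAt I x).symm z ∈ (chartAt H x).source := by
    rw [← extChartAt_source (I := I)]
    exact (extChartAt I x).map_target hz
  refine Eq.trans ?_ (inCoordinates_bilin_apply hzx (g.inner _) v w).symm
  -- The frame of the trivialisation at `x` is the differential of the inverse chart.
  have key : tangentCoordChange I x ((extChartAt I x).symm z) ((extChartAt I x).symm z) =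
      chartFrame I x z := by
    have h := TangentBundle.symmL_trivializationAt (I := I) hzx
    rw [I.range_eq_univ, mfderivWithin_univ, (extChartAt I x).right_inv hz] at h
    exact (TangentBundle.symmL_trivializationAt_eq_core (I := I) hzx).symm.trans h
  rw [key]
  rfl

theorem mvfderiv_apply_eq_fderiv {f : M → ℝ} {x : M} (hf : MDifferentiableAt I 𝓘(ℝ, ℝ) f x)
    (u : TangentSpace I x) :
    mvfderiv I f x u = fderiv ℝ (fun y => f ((extChartAt I x).symm y)) (extChartAt I x x) u := by
  rw [hf.mvfderiv, I.range_eq_univ, fderivWithin_univ]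
  rfl

theorem differentiableAt_comp_extChartAt_symm {f : M → ℝ} {x : M}
    (hf : MDifferentiableAt I 𝓘(ℝ, ℝ) f x) :
    DifferentiableAt ℝ (fun y => f ((extChartAt I x).symm y)) (extChartAt I x x) := by
  have h := hf.differentiableWithinAt_writtenInExtChartAt
  rw [I.range_eq_univ, differentiableWithinAt_univ] at h
  exact h

/-- A smooth vector field is differentiable in the preferred chart. -/
theorem differentiableAt_chartField {t : Π x : M, TangentSpace I x} {x : M}
    (ht : ContMDiffAt I I.tangent ∞ (fun x => (⟨x, t x⟩ : TangentBundle I M)) x) :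
    DifferentiableAt ℝ (chartField t x) (extChartAt I x x) := by
  have : IsManifold I 1 M := .of_le (n := ∞) (by norm_cast)
  have hy := mem_extChartAt_target (I := I) x
  have hs : ContMDiffAt 𝓘(ℝ, E) I ∞ (extChartAt I x).symm (extChartAt I x x) :=
    (contMDiffOn_extChartAt_symm x).contMDiffAt (target_mem_nhds x hy)
  have h := ContMDiffAt.mpullback_vectorField_preimage (n := ∞) (m := ∞) (V := t)
    (by rw [extChartAt_to_inv]; exact ht) hs
    (show (chartFrame I x _).IsInvertible from isInvertible_chartFrame x hy) (by simp)
  exact (contMDiffAt_vectorSpace_iff_contDiffAt.1 h).differentiableAt (by simp)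

theorem covDeriv_eq (g : Metric I M) (t : Π x : M, TangentSpace I x) (x : M) :
    covDeriv g t x = modelCovDeriv (chartMetric g x) (chartField t x) (extChartAt I x x) := rfl

theorem covDeriv_apply (g : Metric I M) (t : Π x : M, TangentSpace I x) (x : M)
    (u : TangentSpace I x) :
    covDeriv g t x u = (fderiv ℝ (chartField t x) (extChartAt I x x) u +
      christoffel (chartMetric g x) (extChartAt I x x) u (t x) : E) := by
  rw [← chartField_self t x]
  rfl

theorem covDeriv_zero (g : Metric I M) (x : M) : covDeriv g (fun _ => 0) x = 0 := by
  have : chartField (fun z : M => (0 : TangentSpace I z)) x = fun _ => 0 := by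
    funext y
    exact map_zero (chartFrame I x y).inverse
  rw [covDeriv_eq, this, modelCovDeriv_zero]
  rfl

theorem covDeriv_sub (g : Metric I M) {s t : Π x : M, TangentSpace I x} {x : M}
    (hs : ContMDiffAt I I.tangent ∞ (fun x => (⟨x, s x⟩ : TangentBundle I M)) x)
    (ht : ContMDiffAt I I.tangent ∞ (fun x => (⟨x, t x⟩ : TangentBundle I M)) x)
    (u : TangentSpace I x) :
    covDeriv g (fun z => s z - t z) x u = covDeriv g s x u - covDeriv g t x u := by
  have e : chartField (fun z => s z - t z) x = fun y => chartField s x y - chartField t x y := by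
    funext y
    exact map_sub (chartFrame I x y).inverse _ _
  rw [covDeriv_eq, e]
  exact modelCovDeriv_sub _ (differentiableAt_chartField hs) (differentiableAt_chartField ht) u

theorem covDeriv_smul (g : Metric I M) {f : M → ℝ} {t : Π x : M, TangentSpace I x} {x : M}
    (hf : MDifferentiableAt I 𝓘(ℝ, ℝ) f x)
    (ht : ContMDiffAt I I.tangent ∞ (fun x => (⟨x, t x⟩ : TangentBundle I M)) x)
    (u : TangentSpace I x) :
    covDeriv g (fun z => f z • t z) x u = mvfderiv I f x u • t x + f x • covDeriv g t x u := by
  have e : chartField (fun z => f z • t z) x =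
      fun y => f ((extChartAt I x).symm y) • chartField t x y := by
    funext y
    exact map_smul (chartFrame I x y).inverse _ _
  have h := modelCovDeriv_smul (chartMetric g x) (differentiableAt_comp_extChartAt_symm hf)
    (differentiableAt_chartField ht) u
  rw [chartField_self, extChartAt_to_inv] at h
  rw [covDeriv_eq, e, mvfderiv_apply_eq_fderiv hf]
  exact h

theorem inner_self_comp_symm_eventuallyEq (g : Metric I M) (t : Π x : M, TangentSpace I x) (x : M) :
    (fun y => g.inner ((extChartAt I x).symm y) (t ((extChartAt I x).symm y))
      (t ((extChartAt I x).symm y))) =ᶠ[𝓝 (extChartAt I x x)]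
      fun y => chartMetric g x y (chartField t x y) (chartField t x y) := by
  filter_upwards [target_mem_nhds x (mem_extChartAt_target (I := I) x)] with y hy
  have h := (isInvertible_chartFrame x hy).self_apply_inverse (t ((extChartAt I x).symm y))
  rw [chartMetric_apply, chartField_apply, h]

theorem mdifferentiableAt_inner_self (g : Metric I M) {t : Π x : M, TangentSpace I x} {x : M}
    (ht : ContMDiffAt I I.tangent ∞ (fun x => (⟨x, t x⟩ : TangentBundle I M)) x) :
    MDifferentiableAt I 𝓘(ℝ, ℝ) (fun z => g.inner z (t z) (t z)) x := by
  have h := (g.contMDiff x).clm_bundle_apply₂ (F₁ := E) (F₂ := E)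
    (E₁ := TangentSpace I) (E₂ := TangentSpace I) (E₃ := Bundle.Trivial M ℝ) ht ht
  simp only [Bundle.contMDiffAt_section] at h
  exact ContMDiffAt.mdifferentiableAt h (by simp)

/-- The Levi-Civita connection is metric: `u (g (t, t)) = 2 g (∇_u t, t)`. -/
theorem mvfderiv_inner_self (g : Metric I M) {t : Π x : M, TangentSpace I x} {x : M}
    (ht : ContMDiffAt I I.tangent ∞ (fun x => (⟨x, t x⟩ : TangentBundle I M)) x)
    (u : TangentSpace I x) :
    mvfderiv I (fun z => g.inner z (t z) (t z)) x u = 2 * g.inner x (covDeriv g t x u) (t x) := by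
  have hy := mem_extChartAt_target (I := I) x
  have h := fderiv_apply_modelCovDeriv
    ((contDiffAt_chartMetric g x hy).differentiableAt (by simp))
    (isInvertible_chartMetric g x hy) (fun y v w => g.symm _ _ _)
    (differentiableAt_chartField ht) u
  rw [chartField_self, chartMetric_self] at h
  rw [mvfderiv_apply_eq_fderiv (mdifferentiableAt_inner_self g ht),
    (inner_self_comp_symm_eventuallyEq g t x).fderiv_eq]
  exact h

end Chart

/-! ### Curvature and covariant derivatives of a product metric -/

theorem inverse_prodMap {E₁ E₂ F₁ F₂ : Type*} [NormedAddCommGroup E₁] [NormedSpace ℝ E₁]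
    [NormedAddCommGroup E₂] [NormedSpace ℝ E₂] [NormedAddCommGroup F₁] [NormedSpace ℝ F₁]
    [NormedAddCommGroup F₂] [NormedSpace ℝ F₂] {A : E₁ →L[ℝ] F₁} {B : E₂ →L[ℝ] F₂}
    (hA : A.IsInvertible) (hB : B.IsInvertible) :
    (A.prodMap B).inverse = A.inverse.prodMap B.inverse := by
  obtain ⟨A, rfl⟩ := hA
  obtain ⟨B, rfl⟩ := hB
  rw [← ContinuousLinearEquiv.coe_prodCongr, ContinuousLinearMap.inverse_equiv,
    ContinuousLinearMap.inverse_equiv, ContinuousLinearMap.inverse_equiv]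
  rfl

theorem inverse_comp_blockForm {E₁ E₂ : Type*} [NormedAddCommGroup E₁] [NormedSpace ℝ E₁]
    [FiniteDimensional ℝ E₁] [NormedAddCommGroup E₂] [NormedSpace ℝ E₂] [FiniteDimensional ℝ E₂]
    {B₁ : E₁ →L[ℝ] E₁ →L[ℝ] ℝ} {B₂ : E₂ →L[ℝ] E₂ →L[ℝ] ℝ} (h₁ : B₁.IsInvertible)
    (h₂ : B₂.IsInvertible) (C₁ : E₁ →L[ℝ] E₁ →L[ℝ] ℝ) (C₂ : E₂ →L[ℝ] E₂ →L[ℝ] ℝ) :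
    (blockForm B₁ B₂).inverse ∘L blockForm C₁ C₂ =
      (B₁.inverse ∘L C₁).prodMap (B₂.inverse ∘L C₂) := by
  refine ContinuousLinearMap.ext fun v => ?_
  have e₁ : (blockForm C₁ C₂ v) ∘L ContinuousLinearMap.inl ℝ E₁ E₂ = C₁ v.1 := by
    ext w; simp [blockForm_apply]
  have e₂ : (blockForm C₁ C₂ v) ∘L ContinuousLinearMap.inr ℝ E₁ E₂ = C₂ v.2 := by
    ext w; simp [blockForm_apply]
  rw [ContinuousLinearMap.comp_apply, blockForm_inverse_apply h₁ h₂, e₁, e₂]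
  rfl

section ProductChart

variable {E₁ : Type*} [NormedAddCommGroup E₁] [NormedSpace ℝ E₁] [FiniteDimensional ℝ E₁]
  {H₁ : Type*} [TopologicalSpace H₁] {I₁ : ModelWithCorners ℝ E₁ H₁} [I₁.Boundaryless]
  {M₁ : Type*} [TopologicalSpace M₁] [ChartedSpace H₁ M₁] [IsManifold I₁ ∞ M₁]
  {E₂ : Type*} [NormedAddCommGroup E₂] [NormedSpace ℝ E₂] [FiniteDimensional ℝ E₂]
  {H₂ : Type*} [TopologicalSpace H₂] {I₂ : ModelWithCorners ℝ E₂ H₂} [I₂.Boundaryless]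
  {M₂ : Type*} [TopologicalSpace M₂] [ChartedSpace H₂ M₂] [IsManifold I₂ ∞ M₂]

variable (I₁ I₂) in
/-- The tangent vector of a product with components `v` and `w`. -/
def tangentPair (p : M₁ × M₂) (v : TangentSpace I₁ p.1) (w : TangentSpace I₂ p.2) :
    TangentSpace (I₁.prod I₂) p :=
  ((v : E₁), (w : E₂))

/-- The block diagonal sum of bilinear forms on the tangent spaces of the factors. -/
def tangentBlock (p : M₁ × M₂) (B₁ : TangentSpace I₁ p.1 →L[ℝ] TangentSpace I₁ p.1 →L[ℝ] ℝ)
    (B₂ : TangentSpace I₂ p.2 →L[ℝ] TangentSpace I₂ p.2 →L[ℝ] ℝ) :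
    TangentSpace (I₁.prod I₂) p →L[ℝ] TangentSpace (I₁.prod I₂) p →L[ℝ] ℝ :=
  blockForm (E₁ := E₁) (E₂ := E₂) B₁ B₂

theorem mem_target_prod {p : M₁ × M₂} {y : E₁ × E₂} :
    y ∈ (extChartAt (I₁.prod I₂) p).target ↔
      y.1 ∈ (extChartAt I₁ p.1).target ∧ y.2 ∈ (extChartAt I₂ p.2).target := by
  rw [extChartAt_prod]
  rfl

theorem extChartAt_symm_prod (p : M₁ × M₂) (y : E₁ × E₂) :
    (extChartAt (I₁.prod I₂) p).symm y =
      ((extChartAt I₁ p.1).symm y.1, (extChartAt I₂ p.2).symm y.2) := by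
  rw [extChartAt_prod]
  rfl

theorem extChartAt_prod_self (p : M₁ × M₂) :
    extChartAt (I₁.prod I₂) p p = (extChartAt I₁ p.1 p.1, extChartAt I₂ p.2 p.2) := by
  rw [extChartAt_prod]
  rfl

/-- The preferred chart of a product is the product of the preferred charts, and on its target both
inverse charts are differentiable. -/
theorem chartFrame_prod {p : M₁ × M₂} {y : E₁ × E₂}
    (hy : y ∈ (extChartAt (I₁.prod I₂) p).target) :
    chartFrame (I₁.prod I₂) p y = (chartFrame I₁ p.1 y.1).prodMap (chartFrame I₂ p.2 y.2) := by
  obtain ⟨h₁, h₂⟩ := mem_target_prod.1 hy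
  have d₁ : MDifferentiableAt 𝓘(ℝ, E₁) I₁ (extChartAt I₁ p.1).symm y.1 :=
    ((contMDiffOn_extChartAt_symm (n := ∞) p.1).contMDiffAt
      (target_mem_nhds p.1 h₁)).mdifferentiableAt (by simp)
  have d₂ : MDifferentiableAt 𝓘(ℝ, E₂) I₂ (extChartAt I₂ p.2).symm y.2 :=
    ((contMDiffOn_extChartAt_symm (n := ∞) p.2).contMDiffAt
      (target_mem_nhds p.2 h₂)).mdifferentiableAt (by simp)
  have k₁ := d₁.hasMFDerivAt.comp y
    (hasFDerivAt_fst (𝕜 := ℝ) (E := E₁) (F := E₂) (p := y)).hasMFDerivAt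
  have k₂ := d₂.hasMFDerivAt.comp y
    (hasFDerivAt_snd (𝕜 := ℝ) (E := E₁) (F := E₂) (p := y)).hasMFDerivAt
  have e : ((extChartAt (I₁.prod I₂) p).symm : E₁ × E₂ → M₁ × M₂) =
      fun y => ((extChartAt I₁ p.1).symm y.1, (extChartAt I₂ p.2).symm y.2) :=
    funext (extChartAt_symm_prod p)
  rw [chartFrame, e]
  exact (k₁.prodMk k₂).mfderiv

theorem chartMetric_prod (g₁ : Metric I₁ M₁) (g₂ : Metric I₂ M₂) {p : M₁ × M₂} {y : E₁ × E₂}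
    (hy : y ∈ (extChartAt (I₁.prod I₂) p).target) :
    chartMetric (prodMetric g₁ g₂) p y =
      blockForm (chartMetric g₁ p.1 y.1) (chartMetric g₂ p.2 y.2) := by
  refine ContinuousLinearMap.ext fun v => ContinuousLinearMap.ext fun w => ?_
  rw [chartMetric_apply, chartFrame_prod hy, extChartAt_symm_prod]
  rfl

theorem chartField_prod (t : Π p : M₁ × M₂, TangentSpace (I₁.prod I₂) p) {p : M₁ × M₂}
    {y : E₁ × E₂} (hy : y ∈ (extChartAt (I₁.prod I₂) p).target) :
    chartField t p y =
      ((chartFrame I₁ p.1 y.1).inverse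
          (t ((extChartAt I₁ p.1).symm y.1, (extChartAt I₂ p.2).symm y.2)).1,
        (chartFrame I₂ p.2 y.2).inverse
          (t ((extChartAt I₁ p.1).symm y.1, (extChartAt I₂ p.2).symm y.2)).2) := by
  obtain ⟨h₁, h₂⟩ := mem_target_prod.1 hy
  rw [chartField_apply, chartFrame_prod hy,
    inverse_prodMap (isInvertible_chartFrame p.1 h₁) (isInvertible_chartFrame p.2 h₂),
    extChartAt_symm_prod]
  rfl

theorem differentiableAt_chartMetric (g₁ : Metric I₁ M₁) (x : M₁) {y : E₁}
    (hy : y ∈ (extChartAt I₁ x).target) : DifferentiableAt ℝ (chartMetric g₁ x) y :=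
  (contDiffAt_chartMetric g₁ x hy).differentiableAt (by simp)

theorem christoffel_prod (g₁ : Metric I₁ M₁) (g₂ : Metric I₂ M₂) {p : M₁ × M₂} {y : E₁ × E₂}
    (hy : y ∈ (extChartAt (I₁.prod I₂) p).target) (u v : E₁ × E₂) :
    christoffel (chartMetric (prodMetric g₁ g₂) p) y u v =
      (christoffel (chartMetric g₁ p.1) y.1 u.1 v.1,
        christoffel (chartMetric g₂ p.2) y.2 u.2 v.2) := by
  obtain ⟨h₁, h₂⟩ := mem_target_prod.1 hy
  have e : chartMetric (prodMetric g₁ g₂) p =ᶠ[𝓝 y]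
      fun z => blockForm (chartMetric g₁ p.1 z.1) (chartMetric g₂ p.2 z.2) := by
    filter_upwards [target_mem_nhds p hy] with z hz using chartMetric_prod g₁ g₂ hz
  rw [christoffel_congr e]
  exact christoffel_blockForm (differentiableAt_chartMetric g₁ p.1 h₁)
    (differentiableAt_chartMetric g₂ p.2 h₂) (isInvertible_chartMetric g₁ p.1 h₁)
    (isInvertible_chartMetric g₂ p.2 h₂) u v

theorem differentiableAt_christoffel_chartMetric (g₁ : Metric I₁ M₁) (x : M₁) :
    DifferentiableAt ℝ (christoffel (chartMetric g₁ x)) (extChartAt I₁ x x) :=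
  differentiableAt_christoffel
    ((contDiffAt_chartMetric g₁ x (mem_extChartAt_target x)).of_le (by norm_cast))
    (isInvertible_chartMetric g₁ x (mem_extChartAt_target x))

/-- The Christoffel symbols split on the whole chart target, which is the neighbourhood that
`chartRicci_block` asks for. -/
theorem ricci_prod (g₁ : Metric I₁ M₁) (g₂ : Metric I₂ M₂) (p : M₁ × M₂) :
    ricci (prodMetric g₁ g₂) p = tangentBlock p (ricci g₁ p.1) (ricci g₂ p.2) := by
  have h := chartRicci_block (Γ₁ := christoffel (chartMetric g₁ p.1))
    (Γ₂ := christoffel (chartMetric g₂ p.2))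
    (differentiableAt_christoffel_chartMetric (prodMetric g₁ g₂) p)
    (by rw [extChartAt_prod_self]; exact differentiableAt_christoffel_chartMetric g₁ p.1)
    (by rw [extChartAt_prod_self]; exact differentiableAt_christoffel_chartMetric g₂ p.2)
    (by filter_upwards [target_mem_nhds p (mem_extChartAt_target (I := I₁.prod I₂) p)] with z hz
          using christoffel_prod g₁ g₂ hz)
  refine h.trans ?_
  rw [extChartAt_prod_self]
  rfl

theorem raise_prod (g₁ : Metric I₁ M₁) (g₂ : Metric I₂ M₂) (p : M₁ × M₂)
    (B₁ : TangentSpace I₁ p.1 →L[ℝ] TangentSpace I₁ p.1 →L[ℝ] ℝ)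
    (B₂ : TangentSpace I₂ p.2 →L[ℝ] TangentSpace I₂ p.2 →L[ℝ] ℝ)
    (v : TangentSpace (I₁.prod I₂) p) :
    raise (prodMetric g₁ g₂) p (tangentBlock p B₁ B₂) v =
      tangentPair I₁ I₂ p (raise g₁ p.1 B₁ v.1) (raise g₂ p.2 B₂ v.2) :=
  DFunLike.congr_fun
    (inverse_comp_blockForm (E₁ := E₁) (E₂ := E₂) (isInvertible_inner g₁ p.1) (isInvertible_inner g₂ p.2) B₁ B₂) v

theorem scal_prod (g₁ : Metric I₁ M₁) (g₂ : Metric I₂ M₂) (p : M₁ × M₂) :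
    scal (prodMetric g₁ g₂) p = scal g₁ p.1 + scal g₂ p.2 := by
  have h := inverse_comp_blockForm (E₁ := E₁) (E₂ := E₂) (isInvertible_inner g₁ p.1) (isInvertible_inner g₂ p.2)
    (ricci g₁ p.1) (ricci g₂ p.2)
  rw [scal, ricci_prod]
  exact (congrArg (fun L : E₁ × E₂ →L[ℝ] E₁ × E₂ => LinearMap.trace ℝ (E₁ × E₂) L.toLinearMap)
    h).trans (LinearMap.trace_prodMap' _ _)

theorem raise_smul_inner (g₁ : Metric I₁ M₁) (x : M₁) (c : ℝ) :
    raise g₁ x (c • g₁.inner x) = c • ContinuousLinearMap.id ℝ (TangentSpace I₁ x) := by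
  refine ContinuousLinearMap.ext fun v => ?_
  change (g₁.inner x : E₁ →L[ℝ] E₁ →L[ℝ] ℝ).inverse (c • (g₁.inner x : E₁ →L[ℝ] E₁ →L[ℝ] ℝ) v) = _
  rw [map_smul, (isInvertible_inner g₁ x).inverse_apply_self]
  rfl

theorem scal_of_ricci_eq {g₁ : Metric I₁ M₁} {x : M₁} {a : ℝ}
    (h : ricci g₁ x = a • g₁.inner x) : scal g₁ x = a * Module.finrank ℝ E₁ := by
  rw [scal, h, raise_smul_inner]
  have : LinearMap.trace ℝ E₁ (a • LinearMap.id) = a * Module.finrank ℝ E₁ := by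
    rw [map_smul, LinearMap.trace_id, smul_eq_mul]
  exact this

/-- The Ricci tensor of an Einstein manifold in terms of the constant of its tractor connection. -/
theorem ricci_eq_of_isTractorConstant {g₁ : Metric I₁ M₁} {c : ℝ}
    (hd : 1 ≤ Module.finrank ℝ E₁) (he : IsEinstein g₁) (hc : IsTractorConstant g₁ c) (x : M₁) :
    ricci g₁ x = (2 * ((Module.finrank ℝ E₁ : ℝ) - 1) * c) • g₁.inner x := by
  rcases hd.eq_or_lt with h1 | h2
  -- In dimension one the factor `d - 1` vanishes and the connection is flat, so any `c` will do.
  · have h := chartRicci_eq_zero_of_finrank_eq_one (christoffel (chartMetric g₁ x))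
      (extChartAt I₁ x x) h1.symm
    rw [← h1]
    norm_num
    exact h
  · obtain ⟨a, ha⟩ := he
    -- Tracing `Ric = a g` gives `Sc = a d`, hence `c = a / (2 (d - 1))`.
    have hs := hc h2 x
    rw [scal_of_ricci_eq (ha x)] at hs
    have h2' : (2 : ℝ) ≤ Module.finrank ℝ E₁ := by exact_mod_cast h2
    rw [ha x]
    congr 1
    rw [hs]
    field_simp [show (Module.finrank ℝ E₁ : ℝ) ≠ 0 by linarith,
      show (Module.finrank ℝ E₁ : ℝ) - 1 ≠ 0 by linarith]

/-- In dimension `d ≥ 3`, `Ric = 2 (d - 1) c g` and `Sc = 2 d (d - 1) c` give `P = (2 (d - 1) c - d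
c) / (d - 2) g = c g`. All dimensions can thus be treated alike. -/
theorem einsteinSchouten_eq {g₁ : Metric I₁ M₁} {c : ℝ}
    (hd : 1 ≤ Module.finrank ℝ E₁) (he : IsEinstein g₁) (hc : IsTractorConstant g₁ c) (x : M₁) :
    einsteinSchouten g₁ c x = c • g₁.inner x := by
  unfold einsteinSchouten
  split_ifs with h3
  · have hr := ricci_eq_of_isTractorConstant hd he hc x
    have h3' : (3 : ℝ) ≤ Module.finrank ℝ E₁ := by exact_mod_cast h3
    rw [schouten, scal_of_ricci_eq hr, hr, ← sub_smul, smul_smul]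
    congr 1
    field_simp [show (Module.finrank ℝ E₁ : ℝ) - 2 ≠ 0 by linarith,
      show (Module.finrank ℝ E₁ : ℝ) - 1 ≠ 0 by linarith]
    ring
  · rfl

/-- With dimensions `m`, `n` and constants `c`, `-c`, the scalar curvature is `2 c (m (m - 1) - n (n
- 1)) = 2 c (m - n) (m + n - 1)`, so `J = c (m - n)`. Subtracting `J` from the Ricci eigenvalues `2
(m - 1) c` and `-2 (n - 1) c` leaves `± c (m + n - 2)`. The opposite signs make the factor `m + n -
2` cancel. -/
theorem schouten_prod {g₁ : Metric I₁ M₁} {g₂ : Metric I₂ M₂} {c : ℝ}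
    (hd₁ : 1 ≤ Module.finrank ℝ E₁) (hd₂ : 1 ≤ Module.finrank ℝ E₂)
    (hd : 3 ≤ Module.finrank ℝ E₁ + Module.finrank ℝ E₂)
    (he₁ : IsEinstein g₁) (he₂ : IsEinstein g₂)
    (hc₁ : IsTractorConstant g₁ c) (hc₂ : IsTractorConstant g₂ (-c)) (p : M₁ × M₂) :
    schouten (prodMetric g₁ g₂) p =
      tangentBlock p (c • g₁.inner p.1) (-c • g₂.inner p.2) := by
  have hr₁ := ricci_eq_of_isTractorConstant hd₁ he₁ hc₁ p.1
  have hr₂ := ricci_eq_of_isTractorConstant hd₂ he₂ hc₂ p.2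
  rw [schouten, ricci_prod, scal_prod, scal_of_ricci_eq hr₁, scal_of_ricci_eq hr₂, hr₁, hr₂,
    Module.finrank_prod]
  have hd' : (3 : ℝ) ≤ Module.finrank ℝ E₁ + Module.finrank ℝ E₂ := by exact_mod_cast hd
  refine ContinuousLinearMap.ext fun v => ContinuousLinearMap.ext fun w => ?_
  have key : ∀ a b m n : ℝ, 3 ≤ m + n → 1 / (m + n - 2) * (2 * (m - 1) * c * a +
      2 * (n - 1) * -c * b - (2 * (m - 1) * c * m + 2 * (n - 1) * -c * n) / (2 * (m + n - 1)) *
        (a + b)) = c * a + -c * b := by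
    intro a b m n h
    field_simp [show m + n - 2 ≠ 0 by linarith, show m + n - 1 ≠ 0 by linarith]
    ring
  have := key (g₁.inner p.1 v.1 w.1) (g₂.inner p.2 v.2 w.2) _ _ hd'
  push_cast
  exact this

theorem modelCovDeriv_prod (g₁ : Metric I₁ M₁) (g₂ : Metric I₂ M₂) (p : M₁ × M₂)
    (T : E₁ × E₂ → E₁ × E₂) (u : E₁ × E₂) :
    modelCovDeriv (chartMetric (prodMetric g₁ g₂) p) T (extChartAt (I₁.prod I₂) p p) u =
      fderiv ℝ T (extChartAt (I₁.prod I₂) p p) u +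
      (christoffel (chartMetric g₁ p.1) (extChartAt I₁ p.1 p.1) u.1
          (T (extChartAt (I₁.prod I₂) p p)).1,
        christoffel (chartMetric g₂ p.2) (extChartAt I₂ p.2 p.2) u.2
          (T (extChartAt (I₁.prod I₂) p p)).2) := by
  rw [modelCovDeriv_apply, christoffel_prod g₁ g₂ (mem_extChartAt_target p)]
  rw [extChartAt_prod_self]

/-- The Christoffel symbols have no mixed terms, so the first component of the derivative in a
direction `(u, 0)` sees only the first component of `t` along the slice. -/
theorem covDeriv_prod_fst (g₁ : Metric I₁ M₁) (g₂ : Metric I₂ M₂)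
    {t : Π p : M₁ × M₂, TangentSpace (I₁.prod I₂) p} {p : M₁ × M₂}
    (ht : ContMDiffAt (I₁.prod I₂) (I₁.prod I₂).tangent ∞
      (fun p => (⟨p, t p⟩ : TangentBundle (I₁.prod I₂) (M₁ × M₂))) p) (u : TangentSpace I₁ p.1) :
    (covDeriv (prodMetric g₁ g₂) t p (tangentPair I₁ I₂ p u 0)).1 =
      covDeriv g₁ (fun x => (t (x, p.2)).1) p.1 u := by
  have hT := differentiableAt_chartField ht
  -- The second coordinate is frozen at the centre of its chart; the first component of the
  -- representative of `t` is then that of the restricted field.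
  have e : (fun z => (chartField t p (z, extChartAt I₂ p.2 p.2)).1) =ᶠ[𝓝 (extChartAt I₁ p.1 p.1)]
      chartField (I := I₁) (fun x => (t (x, p.2)).1) p.1 := by
    filter_upwards [target_mem_nhds p.1 (mem_extChartAt_target (I := I₁) p.1)] with z hz
    rw [chartField_prod t (mem_target_prod.2 ⟨hz, mem_extChartAt_target p.2⟩), extChartAt_to_inv]
    rfl
  have hd : fderiv ℝ (chartField (I := I₁) (fun x => (t (x, p.2)).1) p.1) (extChartAt I₁ p.1 p.1) u =
      (fderiv ℝ (chartField t p) (extChartAt (I₁.prod I₂) p p) (u, 0)).1 := by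
    rw [← e.fderiv_eq]
    rw [extChartAt_prod_self] at hT ⊢
    have h := (hT.hasFDerivAt.comp (extChartAt I₁ p.1 p.1)
      (hasFDerivAt_prodMk_left (𝕜 := ℝ) (extChartAt I₁ p.1 p.1) (extChartAt I₂ p.2 p.2))).fst.fderiv
    exact DFunLike.congr_fun h u
  have h := modelCovDeriv_prod g₁ g₂ p (chartField t p) (u, 0)
  have h' := covDeriv_apply g₁ (fun x => (t (x, p.2)).1) p.1 u
  rw [hd] at h'
  rw [chartField_self] at h
  exact (congrArg Prod.fst h).trans h'.symm

theorem covDeriv_prod_snd (g₁ : Metric I₁ M₁) (g₂ : Metric I₂ M₂)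
    {t : Π p : M₁ × M₂, TangentSpace (I₁.prod I₂) p} {p : M₁ × M₂}
    (ht : ContMDiffAt (I₁.prod I₂) (I₁.prod I₂).tangent ∞
      (fun p => (⟨p, t p⟩ : TangentBundle (I₁.prod I₂) (M₁ × M₂))) p) (u : TangentSpace I₂ p.2) :
    (covDeriv (prodMetric g₁ g₂) t p (tangentPair I₁ I₂ p 0 u)).2 =
      covDeriv g₂ (fun y => (t (p.1, y)).2) p.2 u := by
  have hT := differentiableAt_chartField ht
  have e : (fun z => (chartField t p (extChartAt I₁ p.1 p.1, z)).2) =ᶠ[𝓝 (extChartAt I₂ p.2 p.2)]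
      chartField (I := I₂) (fun y => (t (p.1, y)).2) p.2 := by
    filter_upwards [target_mem_nhds p.2 (mem_extChartAt_target (I := I₂) p.2)] with z hz
    rw [chartField_prod t (mem_target_prod.2 ⟨mem_extChartAt_target p.1, hz⟩), extChartAt_to_inv]
    rfl
  have hd : fderiv ℝ (chartField (I := I₂) (fun y => (t (p.1, y)).2) p.2) (extChartAt I₂ p.2 p.2) u =
      (fderiv ℝ (chartField t p) (extChartAt (I₁.prod I₂) p p) (0, u)).2 := by
    rw [← e.fderiv_eq]
    rw [extChartAt_prod_self] at hT ⊢
    have h := (hT.hasFDerivAt.comp (extChartAt I₂ p.2 p.2)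
      (hasFDerivAt_prodMk_right (𝕜 := ℝ) (extChartAt I₁ p.1 p.1) (extChartAt I₂ p.2 p.2))).snd.fderiv
    exact DFunLike.congr_fun h u
  have h := modelCovDeriv_prod g₁ g₂ p (chartField t p) (0, u)
  have h' := covDeriv_apply g₂ (fun y => (t (p.1, y)).2) p.2 u
  rw [hd] at h'
  rw [chartField_self] at h
  exact (congrArg Prod.snd h).trans h'.symm

/-- The representative of the lift is `(T z.1, 0)`: it does not vary along the second factor, and
the Christoffel symbols of the second factor act on `0`. -/
theorem covDeriv_prod_lift_fst (g₁ : Metric I₁ M₁) (g₂ : Metric I₂ M₂)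
    {t : Π x : M₁, TangentSpace I₁ x} {p : M₁ × M₂}
    (ht : ContMDiffAt I₁ I₁.tangent ∞ (fun x => (⟨x, t x⟩ : TangentBundle I₁ M₁)) p.1)
    (u : TangentSpace (I₁.prod I₂) p) :
    covDeriv (prodMetric g₁ g₂) (fun q => tangentPair I₁ I₂ q (t q.1) 0) p u =
      tangentPair I₁ I₂ p (covDeriv g₁ t p.1 u.1) 0 := by
  have hT := differentiableAt_chartField ht
  have e : chartField (fun q => tangentPair I₁ I₂ q (t q.1) 0) p
      =ᶠ[𝓝 (extChartAt (I₁.prod I₂) p p)] fun z => (chartField t p.1 z.1, 0) := by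
    filter_upwards [target_mem_nhds p (mem_extChartAt_target (I := I₁.prod I₂) p)] with z hz
    rw [chartField_prod _ hz]
    exact Prod.ext rfl (map_zero (chartFrame I₂ p.2 z.2).inverse)
  have hd : fderiv ℝ (chartField (fun q => tangentPair I₁ I₂ q (t q.1) 0) p)
      (extChartAt (I₁.prod I₂) p p) u =
      (fderiv ℝ (chartField t p.1) (extChartAt I₁ p.1 p.1) u.1, 0) := by
    rw [e.fderiv_eq, extChartAt_prod_self]
    have h := ((hT.hasFDerivAt.comp (extChartAt I₁ p.1 p.1, extChartAt I₂ p.2 p.2)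
      (hasFDerivAt_fst (𝕜 := ℝ) (E := E₁) (F := E₂)
        (p := (extChartAt I₁ p.1 p.1, extChartAt I₂ p.2 p.2)))).prodMk
      (hasFDerivAt_const (0 : E₂) _)).fderiv
    exact DFunLike.congr_fun h u
  have h := modelCovDeriv_prod g₁ g₂ p
    (chartField (fun q => tangentPair I₁ I₂ q (t q.1) 0) p) u
  rw [hd, chartField_self, ← covDeriv_eq] at h
  refine h.trans (Prod.ext (covDeriv_apply g₁ t p.1 u.1).symm ?_)
  change (0 : E₂) + christoffel (chartMetric g₂ p.2) (extChartAt I₂ p.2 p.2) u.2 0 = 0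
  rw [map_zero, add_zero]

theorem covDeriv_prod_lift_snd (g₁ : Metric I₁ M₁) (g₂ : Metric I₂ M₂)
    {t : Π y : M₂, TangentSpace I₂ y} {p : M₁ × M₂}
    (ht : ContMDiffAt I₂ I₂.tangent ∞ (fun y => (⟨y, t y⟩ : TangentBundle I₂ M₂)) p.2)
    (u : TangentSpace (I₁.prod I₂) p) :
    covDeriv (prodMetric g₁ g₂) (fun q => tangentPair I₁ I₂ q 0 (t q.2)) p u =
      tangentPair I₁ I₂ p 0 (covDeriv g₂ t p.2 u.2) := by
  have hT := differentiableAt_chartField ht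
  have e : chartField (fun q => tangentPair I₁ I₂ q 0 (t q.2)) p
      =ᶠ[𝓝 (extChartAt (I₁.prod I₂) p p)] fun z => (0, chartField t p.2 z.2) := by
    filter_upwards [target_mem_nhds p (mem_extChartAt_target (I := I₁.prod I₂) p)] with z hz
    rw [chartField_prod _ hz]
    exact Prod.ext (map_zero (chartFrame I₁ p.1 z.1).inverse) rfl
  have hd : fderiv ℝ (chartField (fun q => tangentPair I₁ I₂ q 0 (t q.2)) p)
      (extChartAt (I₁.prod I₂) p p) u =
      (0, fderiv ℝ (chartField t p.2) (extChartAt I₂ p.2 p.2) u.2) := by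
    rw [e.fderiv_eq, extChartAt_prod_self]
    have h := ((hasFDerivAt_const (0 : E₁) _).prodMk
      (hT.hasFDerivAt.comp (extChartAt I₁ p.1 p.1, extChartAt I₂ p.2 p.2)
        (hasFDerivAt_snd (𝕜 := ℝ) (E := E₁) (F := E₂)
          (p := (extChartAt I₁ p.1 p.1, extChartAt I₂ p.2 p.2))))).fderiv
    exact DFunLike.congr_fun h u
  have h := modelCovDeriv_prod g₁ g₂ p
    (chartField (fun q => tangentPair I₁ I₂ q 0 (t q.2)) p) u
  rw [hd, chartField_self, ← covDeriv_eq] at h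
  refine h.trans (Prod.ext ?_ (covDeriv_apply g₂ t p.2 u.2).symm)
  change (0 : E₁) + christoffel (chartMetric g₁ p.1) (extChartAt I₁ p.1 p.1) u.1 0 = 0
  rw [map_zero, add_zero]

end ProductChart

/-! ### Parallel tractors for the Schouten tensor `c g` -/

section Tractor

variable {E : Type*} [NormedAddCommGroup E] [NormedSpace ℝ E] [FiniteDimensional ℝ E]
  {H : Type*} [TopologicalSpace H] {I : ModelWithCorners ℝ E H} [I.Boundaryless]
  {M : Type*} [TopologicalSpace M] [ChartedSpace H M] [IsManifold I ∞ M]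

/-- `f` is differentiable at `x` with vanishing differential. -/
def IsCriticalAt (I : ModelWithCorners ℝ E H) (f : M → ℝ) (x : M) : Prop :=
  MDifferentiableAt I 𝓘(ℝ, ℝ) f x ∧ ∀ u, mvfderiv I f x u = 0

/-- In the chart the differential vanishes on an open set, where level sets are therefore open; no
connectedness of the chart domain is involved. -/
theorem eventually_eq_of_isCriticalAt {f : M → ℝ} {U : Opens M}
    (hf : ∀ x ∈ U, IsCriticalAt I f x) {x : M} (hx : x ∈ U) : ∀ᶠ z in 𝓝 x, f z = f x := by
  have : IsManifold I 1 M := .of_le (n := ∞) (by norm_cast)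
  let s : Set E := (extChartAt I x).target ∩ (extChartAt I x).symm ⁻¹' U
  have hs : IsOpen s :=
    (continuousOn_extChartAt_symm x).isOpen_inter_preimage (isOpen_extChartAt_target x) U.isOpen
  have key : ∀ y ∈ s, HasFDerivAt (fun y => f ((extChartAt I x).symm y)) (0 : E →L[ℝ] ℝ) y := by
    intro y hy
    obtain ⟨hd, h0⟩ := hf _ hy.2
    have hφ : MDifferentiableAt 𝓘(ℝ, E) I (extChartAt I x).symm y :=
      ((contMDiffOn_extChartAt_symm (n := ∞) x).contMDiffAt
        (target_mem_nhds x hy.1)).mdifferentiableAt (by simp)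
    have hc := (hd.hasMFDerivAt.comp y hφ.hasMFDerivAt).hasFDerivAt
    refine hc.congr_fderiv ?_
    ext v
    exact h0 (chartFrame I x y v)
  have ho := hs.isOpen_inter_preimage_of_fderiv_eq_zero
    (fun y hy => (key y hy).differentiableAt.differentiableWithinAt)
    (fun y hy => (key y hy).fderiv) {f x}
  have hmem : extChartAt I x x ∈ s ∩ (fun y => f ((extChartAt I x).symm y)) ⁻¹' {f x} := by
    refine ⟨⟨mem_extChartAt_target x, ?_⟩, ?_⟩
    · rw [Set.mem_preimage, extChartAt_to_inv]; exact hx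
    · rw [Set.mem_preimage, extChartAt_to_inv]; rfl
  filter_upwards [(continuousAt_extChartAt (I := I) x).eventually (ho.mem_nhds hmem),
    extChartAt_source_mem_nhds (I := I) x] with z hz hzs
  have h := hz.2
  rw [Set.mem_preimage, (extChartAt I x).left_inv hzs] at h
  exact h

/-- A family of local functions with vanishing differentials which agree on overlaps is given by a
single constant if the manifold is connected. -/
theorem exists_const_of_isCriticalAt [ConnectedSpace M] {ι : Type*} (U : ι → Opens M)
    (f : ι → M → ℝ) (hU : ∀ x, ∃ i, x ∈ U i) (hf : ∀ i, ∀ x ∈ U i, IsCriticalAt I (f i) x)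
    (hij : ∀ i j, ∀ x ∈ U i, x ∈ U j → f i x = f j x) : ∃ K, ∀ i, ∀ x ∈ U i, f i x = K := by
  -- The index chosen may jump from point to point, but by agreement on overlaps the value does not
  -- depend on it.
  choose j hj using hU
  have hF : IsLocallyConstant fun x => f (j x) x := by
    refine (IsLocallyConstant.iff_eventually_eq _).2 fun x => ?_
    filter_upwards [eventually_eq_of_isCriticalAt (hf (j x)) (hj x),
      (U (j x)).isOpen.mem_nhds (hj x)] with z hz hzU
    rw [hij (j z) (j x) z (hj z) hzU, hz]
  obtain ⟨K, hK⟩ := hF.exists_eq_const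
  exact ⟨K, fun i x hx => (hij i (j x) x hx (hj x)).trans (congrFun hK x)⟩

theorem IsSmoothOn.scaleAt {V : TractorField I M} {U : Opens M} (h : IsSmoothOn V (U : Set M))
    {x : M} (hx : x ∈ U) : ContMDiffAt I 𝓘(ℝ, ℝ) ∞ (fun x => (V x).1) x :=
  h.scale.contMDiffAt (U.isOpen.mem_nhds hx)

theorem IsSmoothOn.vectorAt {V : TractorField I M} {U : Opens M} (h : IsSmoothOn V (U : Set M))
    {x : M} (hx : x ∈ U) :
    ContMDiffAt I I.tangent ∞ (fun x => (⟨x, (V x).2.1⟩ : TangentBundle I M)) x :=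
  h.vector.contMDiffAt (U.isOpen.mem_nhds hx)

theorem IsSmoothOn.bottomAt {V : TractorField I M} {U : Opens M} (h : IsSmoothOn V (U : Set M))
    {x : M} (hx : x ∈ U) : ContMDiffAt I 𝓘(ℝ, ℝ) ∞ (fun x => (V x).2.2) x :=
  h.bottom.contMDiffAt (U.isOpen.mem_nhds hx)

theorem IsParallelOn.mono {g : Metric I M}
    {P : Π x : M, TangentSpace I x →L[ℝ] TangentSpace I x →L[ℝ] ℝ} {V : TractorField I M}
    {U W : Opens M} (h : IsParallelOn g P V U) (hW : W ≤ U) : IsParallelOn g P V W :=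
  ⟨⟨h.smooth.scale.mono hW, h.smooth.vector.mono hW, h.smooth.bottom.mono hW⟩,
    fun x hx => h.parallel x (hW hx)⟩

theorem mvfderiv_sub_apply {f h : M → ℝ} {x : M} (hf : MDifferentiableAt I 𝓘(ℝ, ℝ) f x)
    (hh : MDifferentiableAt I 𝓘(ℝ, ℝ) h x) (u : TangentSpace I x) :
    mvfderiv I (fun z => f z - h z) x u = mvfderiv I f x u - mvfderiv I h x u := by
  rw [mvfderiv_fun_sub hf hh]
  rfl

theorem mvfderiv_mul_apply {f h : M → ℝ} {x : M} (hf : MDifferentiableAt I 𝓘(ℝ, ℝ) f x)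
    (hh : MDifferentiableAt I 𝓘(ℝ, ℝ) h x) (u : TangentSpace I x) :
    mvfderiv I (fun z => f z * h z) x u = f x * mvfderiv I h x u + h x * mvfderiv I f x u := by
  rw [mvfderiv_fun_mul hf hh]
  rfl

theorem mvfderiv_add_apply {f h : M → ℝ} {x : M} (hf : MDifferentiableAt I 𝓘(ℝ, ℝ) f x)
    (hh : MDifferentiableAt I 𝓘(ℝ, ℝ) h x) (u : TangentSpace I x) :
    mvfderiv I (fun z => f z + h z) x u = mvfderiv I f x u + mvfderiv I h x u := by
  rw [mvfderiv_fun_add hf hh]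
  rfl

theorem mvfderiv_const_mul_apply {h : M → ℝ} {x : M} (a : ℝ)
    (hh : MDifferentiableAt I 𝓘(ℝ, ℝ) h x) (u : TangentSpace I x) :
    mvfderiv I (fun z => a * h z) x u = a * mvfderiv I h x u := by
  rw [mvfderiv_mul_apply mdifferentiableAt_const hh, mvfderiv_const]
  simp

theorem IsParallelOn.sub {g : Metric I M}
    {P : Π x : M, TangentSpace I x →L[ℝ] TangentSpace I x →L[ℝ] ℝ} {V W : TractorField I M}
    {U : Opens M} (hV : IsParallelOn g P V U) (hW : IsParallelOn g P W U) :
    IsParallelOn g P (fun x => V x - W x) U := by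
  refine ⟨⟨hV.smooth.scale.sub hW.smooth.scale, ?_, hV.smooth.bottom.sub hW.smooth.bottom⟩, ?_⟩
  · exact hV.smooth.vector.sub_section hW.smooth.vector
  · intro x hx u
    have eV := hV.parallel x hx u
    have eW := hW.parallel x hx u
    simp only [tractorConnection, Prod.mk_eq_zero] at eV eW
    have s := mvfderiv_sub_apply ((hV.smooth.scaleAt hx).mdifferentiableAt (by simp))
      ((hW.smooth.scaleAt hx).mdifferentiableAt (by simp)) u
    have b := mvfderiv_sub_apply ((hV.smooth.bottomAt hx).mdifferentiableAt (by simp))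
      ((hW.smooth.bottomAt hx).mdifferentiableAt (by simp)) u
    have v := covDeriv_sub g (hV.smooth.vectorAt hx) (hW.smooth.vectorAt hx) u
    simp only [tractorConnection, Prod.mk_eq_zero, Prod.fst_sub, Prod.snd_sub]
    refine ⟨?_, ?_, ?_⟩
    · rw [s, map_sub, sub_apply]
      linarith [eV.1, eW.1]
    · rw [v, sub_smul, sub_smul]
      have := congrArg₂ (· - ·) eV.2.1 eW.2.1
      simp only [sub_zero] at this
      rw [← this]
      abel
    · rw [b, map_sub]
      linarith [eV.2.2, eW.2.2]

/-- The multiplier need only have vanishing differential. It will be the pairing of a local tractor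
with the Einstein tractor, on an overlap that may be disconnected. -/
theorem IsParallelOn.smul {g : Metric I M}
    {P : Π x : M, TangentSpace I x →L[ℝ] TangentSpace I x →L[ℝ] ℝ} {V : TractorField I M}
    {U : Opens M} (hV : IsParallelOn g P V U) {f : M → ℝ}
    (hf : ContMDiffOn I 𝓘(ℝ, ℝ) ∞ f U) (hc : ∀ x ∈ U, IsCriticalAt I f x) :
    IsParallelOn g P (fun x => f x • V x) U := by
  refine ⟨⟨hf.mul hV.smooth.scale, ?_, hf.mul hV.smooth.bottom⟩, ?_⟩
  · exact hf.smul_section hV.smooth.vector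
  · intro x hx u
    have eV := hV.parallel x hx u
    simp only [tractorConnection, Prod.mk_eq_zero] at eV
    obtain ⟨hd, h0⟩ := hc x hx
    have s := mvfderiv_mul_apply hd ((hV.smooth.scaleAt hx).mdifferentiableAt (by simp)) u
    have b := mvfderiv_mul_apply hd ((hV.smooth.bottomAt hx).mdifferentiableAt (by simp)) u
    have v := covDeriv_smul g hd (hV.smooth.vectorAt hx) u
    rw [h0] at s b v
    simp only [tractorConnection, Prod.mk_eq_zero, Prod.smul_fst, Prod.smul_snd, smul_eq_mul]
    refine ⟨?_, ?_, ?_⟩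
    · rw [s, map_smul, smul_apply, smul_eq_mul]
      linear_combination (f x) * eV.1
    · rw [v, zero_smul, zero_add, mul_smul, mul_smul, ← smul_add, ← smul_add, eV.2.1, smul_zero]
    · rw [b, map_smul, smul_eq_mul]
      linear_combination (f x) * eV.2.2

/-- The Schouten tensor `c g`. -/
def constSchouten (g : Metric I M) (c : ℝ) (x : M) :
    TangentSpace I x →L[ℝ] TangentSpace I x →L[ℝ] ℝ := c • g.inner x

/-- For `P = c g` the terms `ρ u` and `σ P♯ u` are both multiples of `u`. This is the closed system
in which parallelism is used below. -/
theorem tractorConnection_constSchouten_eq_zero_iff {g : Metric I M} {c : ℝ} {V : TractorField I M}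
    {x : M} {u : TangentSpace I x} :
    tractorConnection g (constSchouten g c) V x u = 0 ↔
      mvfderiv I (fun z => (V z).1) x u = g.inner x (V x).2.1 u ∧
      covDeriv g (fun z => (V z).2.1) x u = -((V x).2.2 + c * (V x).1) • u ∧
      mvfderiv I (fun z => (V z).2.2) x u = c * g.inner x (V x).2.1 u := by
  simp only [tractorConnection, Prod.mk_eq_zero, constSchouten, raise_smul_inner, sub_eq_zero]
  refine and_congr Iff.rfl (and_congr ?_ ?_)
  · rw [add_assoc, add_eq_zero_iff_eq_neg]
    simp only [smul_apply, ContinuousLinearMap.id_apply, smul_smul, ← add_smul, neg_smul,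
      mul_comm c]
  · rw [g.symm x (V x).2.1 u]
    rfl

/-- The tractor metric with the Einstein tractor `(1, 0, -c)`. -/
def einsteinPairing (c : ℝ) {x : M} (v : TractorFibre I x) : ℝ := v.2.2 - c * v.1

/-- The first and third equations give `dρ = c dσ`. -/
theorem isCriticalAt_einsteinPairing {g : Metric I M} {c : ℝ} {V : TractorField I M} {U : Opens M}
    (h : IsParallelOn g (constSchouten g c) V U) {x : M} (hx : x ∈ U) :
    IsCriticalAt I (fun z => einsteinPairing c (V z)) x := by
  have hs := (h.smooth.scaleAt hx).mdifferentiableAt (by simp)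
  have hb := (h.smooth.bottomAt hx).mdifferentiableAt (by simp)
  have hcs : MDifferentiableAt I 𝓘(ℝ, ℝ) (fun z => c * (V z).1) x :=
    mdifferentiableAt_const.mul hs
  refine ⟨hb.sub hcs, fun u => ?_⟩
  obtain ⟨h1, -, h3⟩ := tractorConnection_constSchouten_eq_zero_iff.1 (h.parallel x hx u)
  refine (mvfderiv_sub_apply hb hcs u).trans ?_
  rw [mvfderiv_const_mul_apply c hs, h1, h3, sub_self]

theorem contMDiffOn_einsteinPairing {c : ℝ} {V : TractorField I M} {U : Opens M}
    (h : IsSmoothOn V (U : Set M)) :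
    ContMDiffOn I 𝓘(ℝ, ℝ) ∞ (fun z => einsteinPairing c (V z)) U :=
  h.bottom.sub (contMDiffOn_const.mul h.scale)

/-- The tractor connection is metric: the derivative is `2 ρ g (μ, u) + 2 σ c g (μ, u) - 2 (ρ + c σ)
g (μ, u) = 0`. -/
theorem isCriticalAt_tractorNormSq {g : Metric I M} {c : ℝ} {V : TractorField I M} {U : Opens M}
    (h : IsParallelOn g (constSchouten g c) V U) {x : M} (hx : x ∈ U) :
    IsCriticalAt I (fun z => tractorNormSq g z (V z)) x := by
  have hs := (h.smooth.scaleAt hx).mdifferentiableAt (by simp)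
  have hb := (h.smooth.bottomAt hx).mdifferentiableAt (by simp)
  have hn := mdifferentiableAt_inner_self g (h.smooth.vectorAt hx)
  have h2 : MDifferentiableAt I 𝓘(ℝ, ℝ) (fun z => 2 * (V z).1) x := mdifferentiableAt_const.mul hs
  have hm : MDifferentiableAt I 𝓘(ℝ, ℝ) (fun z => 2 * (V z).1 * (V z).2.2) x := h2.mul hb
  refine ⟨hm.add hn, fun u => ?_⟩
  obtain ⟨e1, e2, e3⟩ := tractorConnection_constSchouten_eq_zero_iff.1 (h.parallel x hx u)
  refine (mvfderiv_add_apply hm hn u).trans ?_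
  rw [mvfderiv_mul_apply h2 hb, mvfderiv_const_mul_apply 2 hs,
    mvfderiv_inner_self g (h.smooth.vectorAt hx), e1, e2, e3, map_smul, smul_apply,
    g.symm x u (V x).2.1, smul_eq_mul]
  ring

/-- The Einstein tractor of a metric with Schouten tensor `c g` is `(1, 0, -c)`. -/
theorem einsteinTractor_eq {g : Metric I M} {c : ℝ} {J : TractorField I M}
    (hd : 1 ≤ Module.finrank ℝ E) (h : IsParallelOn g (constSchouten g c) J ⊤)
    (hJ : ∀ x, (J x).1 = 1) (x : M) : J x = (1, 0, -c) := by
  have hconst : (fun z => (J z).1) = fun _ => (1 : ℝ) := funext hJ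
  -- Since `σ` is constant, `g (μ, ·) = dσ = 0`; this is tested on `μ` itself.
  have hμ : ∀ z, (J z).2.1 = 0 := by
    intro z
    by_contra hne
    obtain ⟨e1, -, -⟩ := tractorConnection_constSchouten_eq_zero_iff.1
      (h.parallel z trivial (J z).2.1)
    rw [hconst, mvfderiv_const] at e1
    exact (g.pos z _ hne).ne e1
  -- Now `∇μ = 0` says `(ρ + c) u = 0`, and a non-zero `u` is needed to conclude `ρ = -c`.
  have : Nontrivial E := Module.finrank_pos_iff.1 hd
  obtain ⟨u, hu⟩ := exists_ne (0 : E)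
  obtain ⟨-, e2, -⟩ := tractorConnection_constSchouten_eq_zero_iff.1
    (h.parallel x trivial u)
  have hμ' : (fun z => (J z).2.1) = fun _ => 0 := funext hμ
  rw [hμ', covDeriv_zero, hJ] at e2
  have e3 : (-((J x).2.2 + c * 1)) • u = 0 := e2.symm
  rcases smul_eq_zero.1 e3 with h0 | h0
  · refine Prod.ext (hJ x) (Prod.ext (hμ x) ?_)
    change (J x).2.2 = -c
    linarith
  · exact (hu h0).elim

end Tractor

/-! ### Splitting and lifting tractors on the product -/

section ProductTractor

variable {E₁ : Type*} [NormedAddCommGroup E₁] [NormedSpace ℝ E₁] [FiniteDimensional ℝ E₁]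
  {H₁ : Type*} [TopologicalSpace H₁] {I₁ : ModelWithCorners ℝ E₁ H₁} [I₁.Boundaryless]
  {M₁ : Type*} [TopologicalSpace M₁] [ChartedSpace H₁ M₁] [IsManifold I₁ ∞ M₁]
  {E₂ : Type*} [NormedAddCommGroup E₂] [NormedSpace ℝ E₂] [FiniteDimensional ℝ E₂]
  {H₂ : Type*} [TopologicalSpace H₂] {I₂ : ModelWithCorners ℝ E₂ H₂} [I₂.Boundaryless]
  {M₂ : Type*} [TopologicalSpace M₂] [ChartedSpace H₂ M₂] [IsManifold I₂ ∞ M₂]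

/-- The Schouten tensor `c₁ g₁ + c₂ g₂` of a product metric. -/
def prodSchouten (g₁ : Metric I₁ M₁) (c₁ : ℝ) (g₂ : Metric I₂ M₂) (c₂ : ℝ) (p : M₁ × M₂) :
    TangentSpace (I₁.prod I₂) p →L[ℝ] TangentSpace (I₁.prod I₂) p →L[ℝ] ℝ :=
  tangentBlock p (c₁ • g₁.inner p.1) (c₂ • g₂.inner p.2)

theorem tractorConnection_prodSchouten_eq_zero_iff {g₁ : Metric I₁ M₁} {c₁ : ℝ} {g₂ : Metric I₂ M₂}
    {c₂ : ℝ} {V : TractorField (I₁.prod I₂) (M₁ × M₂)} {p : M₁ × M₂}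
    {u : TangentSpace (I₁.prod I₂) p} :
    tractorConnection (prodMetric g₁ g₂) (prodSchouten g₁ c₁ g₂ c₂) V p u = 0 ↔
      mvfderiv (I₁.prod I₂) (fun z => (V z).1) p u =
        g₁.inner p.1 (V p).2.1.1 u.1 + g₂.inner p.2 (V p).2.1.2 u.2 ∧
      covDeriv (prodMetric g₁ g₂) (fun z => (V z).2.1) p u = tangentPair I₁ I₂ p
        (-((V p).2.2 + c₁ * (V p).1) • u.1) (-((V p).2.2 + c₂ * (V p).1) • u.2) ∧
      mvfderiv (I₁.prod I₂) (fun z => (V z).2.2) p u =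
        c₁ * g₁.inner p.1 (V p).2.1.1 u.1 + c₂ * g₂.inner p.2 (V p).2.1.2 u.2 := by
  simp only [tractorConnection, Prod.mk_eq_zero, prodSchouten, sub_eq_zero]
  refine and_congr Iff.rfl (and_congr ?_ ?_)
  · rw [add_assoc, add_eq_zero_iff_eq_neg, raise_prod, raise_smul_inner, raise_smul_inner]
    have e : -((V p).2.2 • u + (V p).1 • tangentPair I₁ I₂ p
        ((c₁ • ContinuousLinearMap.id ℝ (TangentSpace I₁ p.1)) u.1)
        ((c₂ • ContinuousLinearMap.id ℝ (TangentSpace I₂ p.2)) u.2)) = tangentPair I₁ I₂ p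
        (-((V p).2.2 + c₁ * (V p).1) • u.1) (-((V p).2.2 + c₂ * (V p).1) • u.2) := by
      have key₁ : ∀ (a b : ℝ) (w : E₁), -(a • w + b • c₁ • w) = -(a + c₁ * b) • w := by
        intro a b w; module
      have key₂ : ∀ (a b : ℝ) (w : E₂), -(a • w + b • c₂ • w) = -(a + c₂ * b) • w := by
        intro a b w; module
      exact Prod.ext (key₁ _ _ _) (key₂ _ _ _)
    rw [e]
  · have k : tangentBlock p (c₁ • g₁.inner p.1) (c₂ • g₂.inner p.2) u (V p).2.1 =
        c₁ * g₁.inner p.1 (V p).2.1.1 u.1 + c₂ * g₂.inner p.2 (V p).2.1.2 u.2 :=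
      congrArg₂ (fun a b => c₁ * a + c₂ * b) (g₁.symm p.1 u.1 (V p).2.1.1)
        (g₂.symm p.2 u.2 (V p).2.1.2)
    rw [k]

/-- The component in the orthogonal complement of the Einstein tractor of the first factor. -/
def splitFst (c : ℝ) (p : M₁ × M₂) (v : TractorFibre (I₁.prod I₂) p) : TractorFibre I₁ p.1 :=
  (1 / 2 * v.1 + 1 / (2 * c) * v.2.2, v.2.1.1, c / 2 * v.1 + 1 / 2 * v.2.2)

/-- The component in the orthogonal complement of the Einstein tractor of the second factor. -/
def splitSnd (c : ℝ) (p : M₁ × M₂) (v : TractorFibre (I₁.prod I₂) p) : TractorFibre I₂ p.2 :=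
  (1 / 2 * v.1 + 1 / (2 * c) * v.2.2, v.2.1.2, c / 2 * v.1 + 1 / 2 * v.2.2)

theorem splitFst_neg (c : ℝ) (p : M₁ × M₂) (v : TractorFibre (I₁.prod I₂) p) :
    splitFst c p (-v) = - splitFst c p v := by
  refine Prod.ext ?_ (Prod.ext rfl ?_) <;>
    simp only [splitFst, Prod.fst_neg, Prod.snd_neg] <;> ring

theorem splitSnd_neg (c : ℝ) (p : M₁ × M₂) (v : TractorFibre (I₁.prod I₂) p) :
    splitSnd c p (-v) = - splitSnd c p v := by
  refine Prod.ext ?_ (Prod.ext rfl ?_) <;>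
    simp only [splitSnd, Prod.fst_neg, Prod.snd_neg] <;> ring

theorem einsteinPairing_splitFst {c : ℝ} (hc : c ≠ 0) (p : M₁ × M₂)
    (v : TractorFibre (I₁.prod I₂) p) : einsteinPairing c (splitFst c p v) = 0 := by
  simp only [einsteinPairing, splitFst]
  field_simp
  ring

theorem einsteinPairing_splitSnd {c : ℝ} (hc : c ≠ 0) (p : M₁ × M₂)
    (v : TractorFibre (I₁.prod I₂) p) : einsteinPairing c (splitSnd c p v) = 0 := by
  simp only [einsteinPairing, splitSnd]
  field_simp
  ring

/-- The bottom slots of the two components are `(ρ + c₁ σ) / 2` and `(ρ - c₁ σ) / 2`, whose sum is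
`ρ`. -/
theorem eq_zero_of_split_eq_zero {c₁ c₂ : ℝ} (h₁₂ : c₂ = -c₁) {p : M₁ × M₂}
    {v : TractorFibre (I₁.prod I₂) p} (h₁ : splitFst c₁ p v = 0) (h₂ : splitSnd c₂ p v = 0) :
    v = 0 := by
  have a₁ : 1 / 2 * v.1 + 1 / (2 * c₁) * v.2.2 = 0 := congrArg Prod.fst h₁
  have b₁ : v.2.1.1 = 0 := congrArg (fun w => w.2.1) h₁
  have d₁ : c₁ / 2 * v.1 + 1 / 2 * v.2.2 = 0 := congrArg (fun w => w.2.2) h₁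
  have b₂ : v.2.1.2 = 0 := congrArg (fun w => w.2.1) h₂
  have d₂ : c₂ / 2 * v.1 + 1 / 2 * v.2.2 = 0 := congrArg (fun w => w.2.2) h₂
  subst h₁₂
  have hρ : v.2.2 = 0 := by linarith
  -- Once `ρ = 0`, the first slot of `splitFst` is `σ / 2`.
  have hσ : v.1 = 0 := by
    rw [hρ] at a₁
    linarith
  exact Prod.ext hσ (Prod.ext (Prod.ext b₁ b₂) hρ)

theorem mvfderiv_slice_fst {f : M₁ × M₂ → ℝ} {x : M₁} {y : M₂}
    (hf : MDifferentiableAt (I₁.prod I₂) 𝓘(ℝ, ℝ) f (x, y)) (u : TangentSpace I₁ x) :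
    mvfderiv I₁ (fun x => f (x, y)) x u =
      mvfderiv (I₁.prod I₂) f (x, y) (tangentPair I₁ I₂ (x, y) u 0) := by
  have h := mvfderiv_comp_apply (f := fun x : M₁ => (x, y)) x hf
    (mdifferentiableAt_id.prodMk mdifferentiableAt_const) u
  refine h.trans ?_
  have e : mfderiv I₁ (I₁.prod I₂) (fun x : M₁ => (x, y)) x u = tangentPair I₁ I₂ (x, y) u 0 :=
    DFunLike.congr_fun (mfderiv_prod_left (I := I₁) (I' := I₂) (x₀ := x) (y₀ := y)) u
  exact congrArg (mvfderiv (I₁.prod I₂) f (x, y)) e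

theorem mvfderiv_slice_snd {f : M₁ × M₂ → ℝ} {x : M₁} {y : M₂}
    (hf : MDifferentiableAt (I₁.prod I₂) 𝓘(ℝ, ℝ) f (x, y)) (u : TangentSpace I₂ y) :
    mvfderiv I₂ (fun y => f (x, y)) y u =
      mvfderiv (I₁.prod I₂) f (x, y) (tangentPair I₁ I₂ (x, y) 0 u) := by
  have h := mvfderiv_comp_apply (f := fun y : M₂ => (x, y)) y hf
    (mdifferentiableAt_const.prodMk mdifferentiableAt_id) u
  refine h.trans ?_
  have e : mfderiv I₂ (I₁.prod I₂) (fun y : M₂ => (x, y)) y u = tangentPair I₁ I₂ (x, y) 0 u :=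
    DFunLike.congr_fun (mfderiv_prod_right (I := I₁) (I' := I₂) (x₀ := x) (y₀ := y)) u
  exact congrArg (mvfderiv (I₁.prod I₂) f (x, y)) e

theorem mvfderiv_comb {E : Type*} [NormedAddCommGroup E] [NormedSpace ℝ E] [FiniteDimensional ℝ E]
    {H : Type*} [TopologicalSpace H] {I : ModelWithCorners ℝ E H}
    {M : Type*} [TopologicalSpace M] [ChartedSpace H M] [IsManifold I ∞ M]
    [I.Boundaryless] {f h : M → ℝ} {x : M} (a b : ℝ)
    (hf : MDifferentiableAt I 𝓘(ℝ, ℝ) f x) (hh : MDifferentiableAt I 𝓘(ℝ, ℝ) h x)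
    (u : TangentSpace I x) :
    mvfderiv I (fun z => a * f z + b * h z) x u = a * mvfderiv I f x u + b * mvfderiv I h x u := by
  have h₁ : MDifferentiableAt I 𝓘(ℝ, ℝ) (fun z => a * f z) x := mdifferentiableAt_const.mul hf
  have h₂ : MDifferentiableAt I 𝓘(ℝ, ℝ) (fun z => b * h z) x := mdifferentiableAt_const.mul hh
  rw [mvfderiv_add_apply h₁ h₂, mvfderiv_const_mul_apply a hf, mvfderiv_const_mul_apply b hh]

/-- The trace on a slice `M₁ × {y}` of an open subset of a product. -/
def sliceOpenFst (U : Opens (M₁ × M₂)) (y : M₂) : Opens M₁ :=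
  U.comap ⟨fun x => (x, y), by fun_prop⟩

/-- The trace on a slice `{x} × M₂` of an open subset of a product. -/
def sliceOpenSnd (U : Opens (M₁ × M₂)) (x : M₁) : Opens M₂ :=
  U.comap ⟨fun y => (x, y), by fun_prop⟩

/-- Along the slice `dσ = g₁ (μ₁, ·)` and `dρ = c₁ g₁ (μ₁, ·)`, so `α σ + β ρ` has differential `(α
+ β c₁) g₁ (μ₁, ·)`. The coefficients in `splitFst` make this factor `1` in the top slot and `c₁` in
the bottom slot. They also leave `ρ + c₁ σ` unchanged, so the equation for `∇μ₁` persists. -/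
theorem isParallelOn_slice_fst {g₁ : Metric I₁ M₁} {c₁ : ℝ} {g₂ : Metric I₂ M₂} {c₂ : ℝ}
    (hc : c₁ ≠ 0) {V : TractorField (I₁.prod I₂) (M₁ × M₂)} {U : Opens (M₁ × M₂)}
    (h : IsParallelOn (prodMetric g₁ g₂) (prodSchouten g₁ c₁ g₂ c₂) V U) (y : M₂) :
    IsParallelOn g₁ (constSchouten g₁ c₁) (fun x => splitFst c₁ (x, y) (V (x, y)))
      (sliceOpenFst U y) := by
  have hmaps : Set.MapsTo (fun x : M₁ => (x, y)) (sliceOpenFst U y) U := fun x hx => hx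
  have hι : ContMDiff I₁ (I₁.prod I₂) ∞ (fun x : M₁ => (x, y)) :=
    contMDiff_id.prodMk contMDiff_const
  have hs := h.smooth.scale.comp hι.contMDiffOn hmaps
  have hb := h.smooth.bottom.comp hι.contMDiffOn hmaps
  refine ⟨⟨?_, ?_, ?_⟩, ?_⟩
  · exact (contMDiffOn_const.mul hs).add (contMDiffOn_const.mul hb)
  -- The vector component is the image of the field along the slice under the tangent map of the
  -- projection.
  · have ht : ContMDiff (I₁.prod I₂).tangent I₁.tangent ∞
        (tangentMap (I₁.prod I₂) I₁ (Prod.fst : M₁ × M₂ → M₁)) :=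
      (contMDiff_fst (n := ∞)).contMDiff_tangentMap (by simp)
    refine (ht.comp_contMDiffOn (h.smooth.vector.comp hι.contMDiffOn hmaps)).congr fun z _ => ?_
    exact (tangentMap_prodFst (I := I₁) (I' := I₂) (M := M₁) (M' := M₂)
      (p := ⟨(z, y), (V (z, y)).2.1⟩)).symm
  · exact (contMDiffOn_const.mul hs).add (contMDiffOn_const.mul hb)
  · intro x hx u
    have hp : (x, y) ∈ U := hx
    have hs := (h.smooth.scaleAt hp).mdifferentiableAt (by simp)
    have hb := (h.smooth.bottomAt hp).mdifferentiableAt (by simp)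
    obtain ⟨e₁, e₂, e₃⟩ := tractorConnection_prodSchouten_eq_zero_iff.1
      (h.parallel (x, y) hp (tangentPair I₁ I₂ (x, y) u 0))
    have cov := covDeriv_prod_fst g₁ g₂ (h.smooth.vectorAt hp) u
    -- Both scalar slots are combinations of `σ` and `ρ`, so one computation serves for both.
    have d : ∀ a b : ℝ, mvfderiv I₁ (fun x => a * (V (x, y)).1 + b * (V (x, y)).2.2) x u =
        (a + b * c₁) * g₁.inner x (V (x, y)).2.1.1 u := by
      intro a b
      have hab : MDifferentiableAt (I₁.prod I₂) 𝓘(ℝ, ℝ) (fun p => a * (V p).1 + b * (V p).2.2)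
        (x, y) := (mdifferentiableAt_const.mul hs).add (mdifferentiableAt_const.mul hb)
      have z : g₂.inner y (V (x, y)).2.1.2 (tangentPair I₁ I₂ (x, y) u 0).2 = 0 :=
        map_zero (g₂.inner y (V (x, y)).2.1.2)
      rw [mvfderiv_slice_fst hab, mvfderiv_comb a b hs hb, e₁, e₃, z]
      simp only [tangentPair]
      ring
    refine tractorConnection_constSchouten_eq_zero_iff.2 ⟨?_, ?_, ?_⟩
    · refine (d _ _).trans ?_
      have : 1 / 2 + 1 / (2 * c₁) * c₁ = 1 := by field_simp; ring
      rw [this, one_mul]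
      rfl
    · rw [e₂] at cov
      refine cov.symm.trans ?_
      have : (c₁ / 2 * (V (x, y)).1 + 1 / 2 * (V (x, y)).2.2 +
          c₁ * (1 / 2 * (V (x, y)).1 + 1 / (2 * c₁) * (V (x, y)).2.2)) =
          (V (x, y)).2.2 + c₁ * (V (x, y)).1 := by field_simp; ring
      simp only [splitFst]
      rw [this]
      rfl
    · refine (d _ _).trans ?_
      have : c₁ / 2 + 1 / 2 * c₁ = c₁ := by ring
      rw [this]
      rfl

theorem isParallelOn_slice_snd {g₁ : Metric I₁ M₁} {c₁ : ℝ} {g₂ : Metric I₂ M₂} {c₂ : ℝ}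
    (hc : c₂ ≠ 0) {V : TractorField (I₁.prod I₂) (M₁ × M₂)} {U : Opens (M₁ × M₂)}
    (h : IsParallelOn (prodMetric g₁ g₂) (prodSchouten g₁ c₁ g₂ c₂) V U) (x : M₁) :
    IsParallelOn g₂ (constSchouten g₂ c₂) (fun y => splitSnd c₂ (x, y) (V (x, y)))
      (sliceOpenSnd U x) := by
  have hmaps : Set.MapsTo (fun y : M₂ => (x, y)) (sliceOpenSnd U x) U := fun x hx => hx
  have hι : ContMDiff I₂ (I₁.prod I₂) ∞ (fun y : M₂ => (x, y)) :=
    contMDiff_const.prodMk contMDiff_id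
  have hs := h.smooth.scale.comp hι.contMDiffOn hmaps
  have hb := h.smooth.bottom.comp hι.contMDiffOn hmaps
  refine ⟨⟨?_, ?_, ?_⟩, ?_⟩
  · exact (contMDiffOn_const.mul hs).add (contMDiffOn_const.mul hb)
  · have ht : ContMDiff (I₁.prod I₂).tangent I₂.tangent ∞
        (tangentMap (I₁.prod I₂) I₂ (Prod.snd : M₁ × M₂ → M₂)) :=
      (contMDiff_snd (n := ∞)).contMDiff_tangentMap (by simp)
    refine (ht.comp_contMDiffOn (h.smooth.vector.comp hι.contMDiffOn hmaps)).congr fun z _ => ?_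
    exact (tangentMap_prodSnd (I := I₁) (I' := I₂) (M := M₁) (M' := M₂)
      (p := ⟨(x, z), (V (x, z)).2.1⟩)).symm
  · exact (contMDiffOn_const.mul hs).add (contMDiffOn_const.mul hb)
  · intro y hy u
    have hp : (x, y) ∈ U := hy
    have hs := (h.smooth.scaleAt hp).mdifferentiableAt (by simp)
    have hb := (h.smooth.bottomAt hp).mdifferentiableAt (by simp)
    obtain ⟨e₁, e₂, e₃⟩ := tractorConnection_prodSchouten_eq_zero_iff.1
      (h.parallel (x, y) hp (tangentPair I₁ I₂ (x, y) 0 u))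
    have cov := covDeriv_prod_snd g₁ g₂ (h.smooth.vectorAt hp) u
    have d : ∀ a b : ℝ, mvfderiv I₂ (fun y => a * (V (x, y)).1 + b * (V (x, y)).2.2) y u =
        (a + b * c₂) * g₂.inner y (V (x, y)).2.1.2 u := by
      intro a b
      have hab : MDifferentiableAt (I₁.prod I₂) 𝓘(ℝ, ℝ) (fun p => a * (V p).1 + b * (V p).2.2)
        (x, y) := (mdifferentiableAt_const.mul hs).add (mdifferentiableAt_const.mul hb)
      have z : g₁.inner x (V (x, y)).2.1.1 (tangentPair I₁ I₂ (x, y) 0 u).1 = 0 :=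
        map_zero (g₁.inner x (V (x, y)).2.1.1)
      rw [mvfderiv_slice_snd hab, mvfderiv_comb a b hs hb, e₁, e₃, z]
      simp only [tangentPair]
      ring
    refine tractorConnection_constSchouten_eq_zero_iff.2 ⟨?_, ?_, ?_⟩
    · refine (d _ _).trans ?_
      have : 1 / 2 + 1 / (2 * c₂) * c₂ = 1 := by field_simp; ring
      rw [this, one_mul]
      rfl
    · rw [e₂] at cov
      refine cov.symm.trans ?_
      have : (c₂ / 2 * (V (x, y)).1 + 1 / 2 * (V (x, y)).2.2 +
          c₂ * (1 / 2 * (V (x, y)).1 + 1 / (2 * c₂) * (V (x, y)).2.2)) =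
          (V (x, y)).2.2 + c₂ * (V (x, y)).1 := by field_simp; ring
      simp only [splitSnd]
      rw [this]
      rfl
    · refine (d _ _).trans ?_
      have : c₂ / 2 + 1 / 2 * c₂ = c₂ := by ring
      rw [this]
      rfl

variable (I₁ M₁ I₂ M₂) in
/-- The lift to the product of a tractor field on the first factor. -/
def liftFst (V : TractorField I₁ M₁) : TractorField (I₁.prod I₂) (M₁ × M₂) :=
  fun p => ((V p.1).1, tangentPair I₁ I₂ p (V p.1).2.1 0, (V p.1).2.2)

variable (I₁ M₁ I₂ M₂) in
/-- The lift to the product of a tractor field on the second factor. -/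
def liftSnd (V : TractorField I₂ M₂) : TractorField (I₁.prod I₂) (M₁ × M₂) :=
  fun p => ((V p.2).1, tangentPair I₁ I₂ p 0 (V p.2).2.1, (V p.2).2.2)

theorem mvfderiv_comp_fst {f : M₁ → ℝ} {p : M₁ × M₂} (hf : MDifferentiableAt I₁ 𝓘(ℝ, ℝ) f p.1)
    (u : TangentSpace (I₁.prod I₂) p) :
    mvfderiv (I₁.prod I₂) (fun q : M₁ × M₂ => f q.1) p u = mvfderiv I₁ f p.1 u.1 := by
  have h := mvfderiv_comp_apply (f := (Prod.fst : M₁ × M₂ → M₁)) p hf mdifferentiableAt_fst u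
  rw [mfderiv_fst] at h
  exact h

theorem mvfderiv_comp_snd {f : M₂ → ℝ} {p : M₁ × M₂} (hf : MDifferentiableAt I₂ 𝓘(ℝ, ℝ) f p.2)
    (u : TangentSpace (I₁.prod I₂) p) :
    mvfderiv (I₁.prod I₂) (fun q : M₁ × M₂ => f q.2) p u = mvfderiv I₂ f p.2 u.2 := by
  have h := mvfderiv_comp_apply (f := (Prod.snd : M₁ × M₂ → M₂)) p hf mdifferentiableAt_snd u
  rw [mfderiv_snd] at h
  exact h

theorem contMDiffOn_tangentPair {U : Set (M₁ × M₂)} {s : Π p : M₁ × M₂, TangentSpace I₁ p.1}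
    {t : Π p : M₁ × M₂, TangentSpace I₂ p.2}
    (hs : ContMDiffOn (I₁.prod I₂) I₁.tangent ∞
      (fun p => (⟨p.1, s p⟩ : TangentBundle I₁ M₁)) U)
    (ht : ContMDiffOn (I₁.prod I₂) I₂.tangent ∞
      (fun p => (⟨p.2, t p⟩ : TangentBundle I₂ M₂)) U) :
    ContMDiffOn (I₁.prod I₂) (I₁.prod I₂).tangent ∞
      (fun p => (⟨p, tangentPair I₁ I₂ p (s p) (t p)⟩ :
        TangentBundle (I₁.prod I₂) (M₁ × M₂))) U := by
  have : IsManifold I₁ (∞ + 1) M₁ := .of_le (n := ∞) (by simp)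
  have : IsManifold I₂ (∞ + 1) M₂ := .of_le (n := ∞) (by simp)
  exact (contMDiff_equivTangentBundleProd_symm (I := I₁) (M := M₁) (I' := I₂) (M' := M₂)
    (n := ∞)).comp_contMDiffOn (hs.prodMk ht)

theorem contMDiff_zero_vectorField : ContMDiff I₁ I₁.tangent ∞
    (fun x : M₁ => (⟨x, 0⟩ : TangentBundle I₁ M₁)) :=
  Bundle.contMDiff_zeroSection ℝ (TangentSpace I₁)

/-- In directions tangent to the second factor the vector equation for `(σ, (μ, 0), ρ)` reads `0 =
-(ρ + c₂ σ) u₂`. As `c₂ = -c₁`, the coefficient is the pairing with the Einstein tractor; this is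
where orthogonality enters. The remaining equations are those of the first factor. -/
theorem isParallelOn_liftFst {g₁ : Metric I₁ M₁} {c₁ : ℝ} (g₂ : Metric I₂ M₂) {c₂ : ℝ}
    (h₁₂ : c₂ = -c₁) {V : TractorField I₁ M₁} {U : Opens M₁}
    (h : IsParallelOn g₁ (constSchouten g₁ c₁) V U)
    (hV : ∀ x ∈ U, einsteinPairing c₁ (V x) = 0) :
    IsParallelOn (prodMetric g₁ g₂) (prodSchouten g₁ c₁ g₂ c₂) (liftFst I₁ M₁ I₂ M₂ V)
      (U.comap ⟨Prod.fst, continuous_fst⟩) := by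
  have hmaps : Set.MapsTo (Prod.fst : M₁ × M₂ → M₁)
    (U.comap ⟨Prod.fst, continuous_fst⟩ : Opens (M₁ × M₂)) U := fun x hx => hx
  refine ⟨⟨?_, ?_, ?_⟩, ?_⟩
  · exact h.smooth.scale.comp contMDiffOn_fst hmaps
  · exact contMDiffOn_tangentPair (h.smooth.vector.comp contMDiffOn_fst hmaps)
      (contMDiff_zero_vectorField.comp_contMDiffOn contMDiffOn_snd)
  · exact h.smooth.bottom.comp contMDiffOn_fst hmaps
  · intro p hp u
    have hx : p.1 ∈ U := hp
    obtain ⟨e₁, e₂, e₃⟩ := tractorConnection_constSchouten_eq_zero_iff.1 (h.parallel p.1 hx u.1)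
    have z : g₂.inner p.2 (0 : TangentSpace I₂ p.2) u.2 = 0 := by
      rw [map_zero]
      rfl
    refine tractorConnection_prodSchouten_eq_zero_iff.2 ⟨?_, ?_, ?_⟩
    · refine (mvfderiv_comp_fst ((h.smooth.scaleAt hx).mdifferentiableAt (by simp)) u).trans ?_
      rw [e₁]
      change _ = g₁.inner p.1 (V p.1).2.1 u.1 + g₂.inner p.2 (0 : TangentSpace I₂ p.2) u.2
      rw [z, add_zero]
    · refine (covDeriv_prod_lift_fst g₁ g₂ (h.smooth.vectorAt hx) u).trans ?_
      rw [e₂]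
      have hk : (V p.1).2.2 + c₂ * (V p.1).1 = 0 := by
        have := hV p.1 hx
        rw [einsteinPairing] at this
        rw [h₁₂]
        linarith
      simp only [liftFst]
      rw [hk, neg_zero, zero_smul]
      rfl
    · refine (mvfderiv_comp_fst ((h.smooth.bottomAt hx).mdifferentiableAt (by simp)) u).trans ?_
      rw [e₃]
      change _ = c₁ * g₁.inner p.1 (V p.1).2.1 u.1 +
        c₂ * g₂.inner p.2 (0 : TangentSpace I₂ p.2) u.2
      rw [z, mul_zero, add_zero]

theorem isParallelOn_liftSnd (g₁ : Metric I₁ M₁) {c₁ : ℝ} {g₂ : Metric I₂ M₂} {c₂ : ℝ}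
    (h₁₂ : c₂ = -c₁) {V : TractorField I₂ M₂} {U : Opens M₂}
    (h : IsParallelOn g₂ (constSchouten g₂ c₂) V U)
    (hV : ∀ x ∈ U, einsteinPairing c₂ (V x) = 0) :
    IsParallelOn (prodMetric g₁ g₂) (prodSchouten g₁ c₁ g₂ c₂) (liftSnd I₁ M₁ I₂ M₂ V)
      (U.comap ⟨Prod.snd, continuous_snd⟩) := by
  have hmaps : Set.MapsTo (Prod.snd : M₁ × M₂ → M₂)
    (U.comap ⟨Prod.snd, continuous_snd⟩ : Opens (M₁ × M₂)) U := fun x hx => hx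
  refine ⟨⟨?_, ?_, ?_⟩, ?_⟩
  · exact h.smooth.scale.comp contMDiffOn_snd hmaps
  · exact contMDiffOn_tangentPair (contMDiff_zero_vectorField.comp_contMDiffOn contMDiffOn_fst)
      (h.smooth.vector.comp contMDiffOn_snd hmaps)
  · exact h.smooth.bottom.comp contMDiffOn_snd hmaps
  · intro p hp u
    have hx : p.2 ∈ U := hp
    obtain ⟨e₁, e₂, e₃⟩ := tractorConnection_constSchouten_eq_zero_iff.1 (h.parallel p.2 hx u.2)
    have z : g₁.inner p.1 (0 : TangentSpace I₁ p.1) u.1 = 0 := by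
      rw [map_zero]
      rfl
    refine tractorConnection_prodSchouten_eq_zero_iff.2 ⟨?_, ?_, ?_⟩
    · refine (mvfderiv_comp_snd ((h.smooth.scaleAt hx).mdifferentiableAt (by simp)) u).trans ?_
      rw [e₁]
      change _ = g₁.inner p.1 (0 : TangentSpace I₁ p.1) u.1 + g₂.inner p.2 (V p.2).2.1 u.2
      rw [z, zero_add]
    · refine (covDeriv_prod_lift_snd g₁ g₂ (h.smooth.vectorAt hx) u).trans ?_
      rw [e₂]
      have hk : (V p.2).2.2 + c₁ * (V p.2).1 = 0 := by
        have := hV p.2 hx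
        rw [einsteinPairing, h₁₂] at this
        linarith
      simp only [liftSnd]
      rw [hk, neg_zero, zero_smul]
      rfl
    · refine (mvfderiv_comp_snd ((h.smooth.bottomAt hx).mdifferentiableAt (by simp)) u).trans ?_
      rw [e₃]
      change _ = c₁ * g₁.inner p.1 (0 : TangentSpace I₁ p.1) u.1 +
        c₂ * g₂.inner p.2 (V p.2).2.1 u.2
      rw [z, mul_zero, zero_add]

end ProductTractor

/-! ### Structures orthogonal to the Einstein tractor -/

section AlmostEinstein

variable {E : Type*} [NormedAddCommGroup E] [NormedSpace ℝ E] [FiniteDimensional ℝ E]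
  {H : Type*} [TopologicalSpace H] {I : ModelWithCorners ℝ E H} [I.Boundaryless]
  {M : Type*} [TopologicalSpace M] [ChartedSpace H M] [IsManifold I ∞ M]

theorem einsteinPairing_neg (c : ℝ) {x : M} (v : TractorFibre I x) :
    einsteinPairing c (-v) = -einsteinPairing c v := by
  simp only [einsteinPairing, Prod.fst_neg, Prod.snd_neg]
  ring

theorem einsteinPairing_comb (c a b : ℝ) {x : M} (v w : TractorFibre I x) :
    einsteinPairing c (a • v - b • w) = a * einsteinPairing c v - b * einsteinPairing c w := by
  simp only [einsteinPairing, Prod.fst_sub, Prod.snd_sub, Prod.smul_fst, Prod.smul_snd, smul_eq_mul]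
  ring

theorem tractorNormSq_neg (g : Metric I M) {x : M} (v : TractorFibre I x) :
    tractorNormSq g x (-v) = tractorNormSq g x v := by
  simp only [tractorNormSq, Prod.fst_neg, Prod.snd_neg, map_neg, neg_apply]
  ring

theorem tractorNormSq_zero (g : Metric I M) (x : M) :
    tractorNormSq g x (0 : TractorFibre I x) = 0 := by
  simp [tractorNormSq]

/-- For `c > 0` the tractor metric is definite on the complement of the Einstein tractor. -/
theorem eq_zero_of_tractorNormSq_eq_zero {g : Metric I M} {c : ℝ} (hc : 0 < c) {x : M}
    {v : TractorFibre I x} (h : tractorNormSq g x v = 0) (hv : einsteinPairing c v = 0) : v = 0 := by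
  rw [tractorNormSq] at h
  rw [einsteinPairing, sub_eq_zero] at hv
  -- On the complement `ρ = c σ`, so the squared norm is `2 c σ² + g (μ, μ)`.
  have hμ : v.2.1 = 0 := by
    by_contra hne
    have := g.pos x v.2.1 hne
    rw [hv] at h
    nlinarith [mul_nonneg hc.le (mul_self_nonneg v.1)]
  rw [hμ, hv, map_zero, add_zero] at h
  have hσ : v.1 = 0 := by
    have h' : c * (v.1 * v.1) = 0 := by linarith
    exact mul_self_eq_zero.1 ((mul_eq_zero.1 h').resolve_left hc.ne')
  refine Prod.ext hσ (Prod.ext hμ ?_)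
  rw [hv, hσ, mul_zero]
  rfl

/-- Pairing a linear relation with the Einstein tractor kills the `v` term and so the coefficient of
`w`. -/
theorem linearIndependent_pair_of_einsteinPairing {c : ℝ} {x : M} {v w : TractorFibre I x}
    (hv : v ≠ 0) (h : einsteinPairing c v = 0) (hw : einsteinPairing c w ≠ 0) :
    LinearIndependent ℝ ![v, w] := by
  rw [LinearIndependent.pair_iff]
  intro s t hst
  have h0 := congrArg (einsteinPairing c) hst
  have h1 := einsteinPairing_comb c s (-t) v w
  rw [neg_smul, sub_neg_eq_add, h0, h] at h1
  have ht : t = 0 := by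
    have h2 : t * einsteinPairing c w = 0 := by
      have : einsteinPairing c (0 : TractorFibre I x) = 0 := by simp [einsteinPairing]
      rw [this] at h1
      linarith
    exact (mul_eq_zero.1 h2).resolve_right hw
  rw [ht, zero_smul, add_zero] at hst
  exact ⟨(smul_eq_zero.1 hst).resolve_right hv, ht⟩

theorem exists_const_einsteinPairing {g : Metric I M} {c : ℝ} [ConnectedSpace M]
    {V : TractorField I M} (h : IsParallelOn g (constSchouten g c) V ⊤) :
    ∃ K, ∀ x, einsteinPairing c (V x) = K := by
  obtain ⟨K, hK⟩ := exists_const_of_isCriticalAt (I := I) (fun _ : Unit => (⊤ : Opens M))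
    (fun _ x => einsteinPairing c (V x)) (fun x => ⟨(), trivial⟩)
    (fun _ x hx => isCriticalAt_einsteinPairing h hx) (fun _ _ _ _ _ => rfl)
  exact ⟨K, fun x => hK () x trivial⟩

/-- By connectedness the pairings of `V` and `W` with the Einstein tractor are constants `a` and
`b`, and `b V - a W` is orthogonal to it. Independence makes this non-zero when `a ≠ 0`; when `a =
0`, `V` itself serves. -/
theorem AdmitsTwoDirectedAE.exists_orthogonal [ConnectedSpace M] {g : Metric I M} {c : ℝ}
    (h : AdmitsTwoDirectedAE g (constSchouten g c)) :
    ∃ V, IsDirectedAE g (constSchouten g c) V ∧ ∀ x, einsteinPairing c (V x) = 0 := by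
  obtain ⟨V, W, hV, hW, hi⟩ := h
  obtain ⟨a, ha⟩ := exists_const_einsteinPairing hV.parallel
  obtain ⟨b, hb⟩ := exists_const_einsteinPairing hW.parallel
  by_cases h0 : a = 0
  · exact ⟨V, hV, fun x => (ha x).trans h0⟩
  refine ⟨fun x => b • V x - a • W x, ⟨?_, ?_⟩, fun x => ?_⟩
  · have hcrit : ∀ r : ℝ, ∀ x ∈ (⊤ : Opens M), IsCriticalAt I (fun _ => r) x := fun r x _ =>
      ⟨mdifferentiableAt_const, fun u => by rw [mvfderiv_const]; rfl⟩
    exact (hV.parallel.smul contMDiffOn_const (hcrit b)).sub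
      (hW.parallel.smul contMDiffOn_const (hcrit a))
  · intro hz
    have hz' : b • V + (-a) • W = 0 := by
      rw [← hz]
      funext x
      change b • V x + (-a) • W x = b • V x - a • W x
      rw [neg_smul, sub_eq_add_neg]
    exact h0 (neg_eq_zero.1 (LinearIndependent.pair_iff.1 hi _ _ hz').2)
  · rw [einsteinPairing_comb, ha, hb]
    ring

/-- An even function of the tractor does not see the sign ambiguity, so its local values glue to a
locally constant function on `M`. -/
theorem exists_const_of_isAE [ConnectedSpace M] {A : Set (Opens M × TractorField I M)}
    (hcover : ∀ x : M, ∃ a ∈ A, x ∈ a.1)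
    (hover : ∀ a ∈ A, ∀ b ∈ A,
      (∀ x ∈ a.1 ⊓ b.1, a.2 x = b.2 x) ∨ (∀ x ∈ a.1 ⊓ b.1, a.2 x = - b.2 x))
    (Q : ∀ x : M, TractorFibre I x → ℝ) (hQ : ∀ x v, Q x (-v) = Q x v)
    (hcrit : ∀ a ∈ A, ∀ x ∈ a.1, IsCriticalAt I (fun z => Q z (a.2 z)) x) :
    ∃ K, ∀ a ∈ A, ∀ x ∈ a.1, Q x (a.2 x) = K := by
  obtain ⟨K, hK⟩ := exists_const_of_isCriticalAt (I := I) (fun a : A => a.1.1)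
    (fun a x => Q x (a.1.2 x))
    (fun x => by obtain ⟨a, ha, hx⟩ := hcover x; exact ⟨⟨a, ha⟩, hx⟩)
    (fun a x hx => hcrit a.1 a.2 x hx)
    (fun a b x hx hx' => by
      rcases hover a.1 a.2 b.1 b.2 with h | h
      · simp only [h x ⟨hx, hx'⟩]
      · simp only [h x ⟨hx, hx'⟩, hQ])
  exact ⟨K, fun a ha x hx => hK ⟨a, ha⟩ x hx⟩

/-- The pairing is defined only up to sign, but its square on `A` is a constant `K`. If `K = 0`,
then `A` is orthogonal. Otherwise the pairing has no zeros on `A`, and independence makes the local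
combinations below nowhere zero. -/
theorem AdmitsTwoAE.exists_orthogonal [ConnectedSpace M] {g : Metric I M} {c : ℝ}
    (h : AdmitsTwoAE g (constSchouten g c)) :
    ∃ A, IsAE g (constSchouten g c) A ∧ ∀ a ∈ A, ∀ x ∈ a.1, einsteinPairing c (a.2 x) = 0 := by
  obtain ⟨A, B, hA, hB, hi⟩ := h
  obtain ⟨K, hK⟩ := exists_const_of_isAE hA.cover hA.overlap
    (fun x v => einsteinPairing c v * einsteinPairing c v)
    (fun x v => by rw [einsteinPairing_neg]; ring)
    (fun a ha x hx => by
      have h := isCriticalAt_einsteinPairing (hA.parallel a ha) hx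
      refine ⟨h.1.mul h.1, fun u => ?_⟩
      refine (mvfderiv_mul_apply h.1 h.1 u).trans ?_
      rw [h.2 u]
      ring)
  by_cases h0 : K = 0
  · exact ⟨A, hA, fun a ha x hx => mul_self_eq_zero.1 ((hK a ha x hx).trans h0)⟩
  have hA0 : ∀ a ∈ A, ∀ x ∈ a.1, einsteinPairing c (a.2 x) ≠ 0 := fun a ha x hx hz =>
    h0 (by rw [← hK a ha x hx, hz, mul_zero])
  -- The combination is linear in each of the two tractors, so sign changes of `a` and `b` change it
  -- by the product of the signs.
  let comb : (Opens M × TractorField I M) → (Opens M × TractorField I M) →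
      (Opens M × TractorField I M) := fun a b => (a.1 ⊓ b.1, fun x =>
        einsteinPairing c (b.2 x) • a.2 x - einsteinPairing c (a.2 x) • b.2 x)
  refine ⟨Set.image2 comb A B, ⟨?_, ?_, ?_, ?_⟩, ?_⟩
  · intro x
    obtain ⟨a, ha, hxa⟩ := hA.cover x
    obtain ⟨b, hb, hxb⟩ := hB.cover x
    exact ⟨comb a b, Set.mem_image2_of_mem ha hb, hxa, hxb⟩
  · rintro - ⟨a, ha, b, hb, rfl⟩
    have pa : IsParallelOn g (constSchouten g c) a.2 (a.1 ⊓ b.1) :=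
      (hA.parallel a ha).mono inf_le_left
    have pb : IsParallelOn g (constSchouten g c) b.2 (a.1 ⊓ b.1) :=
      (hB.parallel b hb).mono inf_le_right
    exact (pa.smul (contMDiffOn_einsteinPairing pb.smooth)
        fun x hx => isCriticalAt_einsteinPairing pb hx).sub
      (pb.smul (contMDiffOn_einsteinPairing pa.smooth)
        fun x hx => isCriticalAt_einsteinPairing pa hx)
  · rintro - ⟨a, ha, b, hb, rfl⟩ x hx hz
    have hz' : einsteinPairing c (b.2 x) • a.2 x + (-einsteinPairing c (a.2 x)) • b.2 x = 0 := by
      rw [neg_smul, ← sub_eq_add_neg]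
      exact hz
    exact hA0 a ha x hx.1
      (neg_eq_zero.1 (LinearIndependent.pair_iff.1 (hi a ha b hb x hx) _ _ hz').2)
  · rintro - ⟨a, ha, b, hb, rfl⟩ - ⟨a', ha', b', hb', rfl⟩
    rcases hA.overlap a ha a' ha' with h | h <;> rcases hB.overlap b hb b' hb' with k | k
    · left
      rintro x ⟨⟨h1, h2⟩, ⟨h3, h4⟩⟩
      simp only [comb, h x ⟨h1, h3⟩, k x ⟨h2, h4⟩]
    · right
      rintro x ⟨⟨h1, h2⟩, ⟨h3, h4⟩⟩
      simp only [comb, h x ⟨h1, h3⟩, k x ⟨h2, h4⟩, einsteinPairing_neg, neg_smul, smul_neg]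
      abel
    · right
      rintro x ⟨⟨h1, h2⟩, ⟨h3, h4⟩⟩
      simp only [comb, h x ⟨h1, h3⟩, k x ⟨h2, h4⟩, einsteinPairing_neg, neg_smul, smul_neg]
      abel
    · left
      rintro x ⟨⟨h1, h2⟩, ⟨h3, h4⟩⟩
      simp only [comb, h x ⟨h1, h3⟩, k x ⟨h2, h4⟩, einsteinPairing_neg, neg_smul, smul_neg, neg_neg]
  · rintro - ⟨a, ha, b, hb, rfl⟩ x hx
    simp only [comb, einsteinPairing_comb]
    ring

/-- A parallel tractor orthogonal to the Einstein tractor is a second directed almost Einstein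
structure. -/
theorem admitsTwoDirectedAE_of_orthogonal {g : Metric I M} {c : ℝ} {J V : TractorField I M}
    (hJ : IsParallelOn g (constSchouten g c) J ⊤) (hJ0 : ∀ x, einsteinPairing c (J x) ≠ 0)
    (hV : IsParallelOn g (constSchouten g c) V ⊤) (hV0 : ∀ x, einsteinPairing c (V x) = 0)
    {x : M} (hx : V x ≠ 0) : AdmitsTwoDirectedAE g (constSchouten g c) := by
  refine ⟨V, J, ⟨hV, fun h => hx (congrFun h x)⟩, ⟨hJ, fun h => hJ0 x ?_⟩, ?_⟩
  · rw [h]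
    simp [einsteinPairing]
  · have hi := linearIndependent_pair_of_einsteinPairing hx (hV0 x) (hJ0 x)
    rw [LinearIndependent.pair_iff] at hi ⊢
    exact fun s t hst => hi s t (congrFun hst x)

/-- The globally defined `J` is a structure with a single member. It is nowhere zero and independent
of an orthogonal tractor because its pairing never vanishes. -/
theorem admitsTwoAE_of_orthogonal {g : Metric I M} {c : ℝ} {J : TractorField I M}
    (hJ : IsParallelOn g (constSchouten g c) J ⊤) (hJ0 : ∀ x, einsteinPairing c (J x) ≠ 0)
    {A : Set (Opens M × TractorField I M)} (hA : IsAE g (constSchouten g c) A)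
    (hA0 : ∀ a ∈ A, ∀ x ∈ a.1, einsteinPairing c (a.2 x) = 0) :
    AdmitsTwoAE g (constSchouten g c) := by
  refine ⟨A, {(⊤, J)}, hA, ⟨fun x => ⟨_, rfl, trivial⟩, ?_, ?_, ?_⟩, ?_⟩
  · rintro - rfl
    exact hJ
  · rintro - rfl x -
    intro h
    refine hJ0 x ?_
    rw [show J x = 0 from h]
    simp [einsteinPairing]
  · rintro - rfl - rfl
    exact Or.inl fun _ _ => rfl
  · rintro a ha - rfl x hx
    exact linearIndependent_pair_of_einsteinPairing (hA.ne_zero a ha x hx.1) (hA0 a ha x hx.1)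
      (hJ0 x)

end AlmostEinstein

/-! ### The two equivalences on the product -/

section ProductAlmostEinstein

variable {E₁ : Type*} [NormedAddCommGroup E₁] [NormedSpace ℝ E₁] [FiniteDimensional ℝ E₁]
  {H₁ : Type*} [TopologicalSpace H₁] {I₁ : ModelWithCorners ℝ E₁ H₁} [I₁.Boundaryless]
  {M₁ : Type*} [TopologicalSpace M₁] [ChartedSpace H₁ M₁] [IsManifold I₁ ∞ M₁] [ConnectedSpace M₁]
  {E₂ : Type*} [NormedAddCommGroup E₂] [NormedSpace ℝ E₂] [FiniteDimensional ℝ E₂]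
  {H₂ : Type*} [TopologicalSpace H₂] {I₂ : ModelWithCorners ℝ E₂ H₂} [I₂.Boundaryless]
  {M₂ : Type*} [TopologicalSpace M₂] [ChartedSpace H₂ M₂] [IsManifold I₂ ∞ M₂] [ConnectedSpace M₂]

theorem liftFst_ne_zero {V : TractorField I₁ M₁} {p : M₁ × M₂} (h : V p.1 ≠ 0) :
    liftFst I₁ M₁ I₂ M₂ V p ≠ 0 := fun h0 =>
  h (Prod.ext (congrArg (fun w : TractorFibre (I₁.prod I₂) p => w.1) h0)
    (Prod.ext (congrArg (fun w : TractorFibre (I₁.prod I₂) p => w.2.1.1) h0)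
      (congrArg (fun w : TractorFibre (I₁.prod I₂) p => w.2.2) h0)))

theorem liftSnd_ne_zero {V : TractorField I₂ M₂} {p : M₁ × M₂} (h : V p.2 ≠ 0) :
    liftSnd I₁ M₁ I₂ M₂ V p ≠ 0 := fun h0 =>
  h (Prod.ext (congrArg (fun w : TractorFibre (I₁.prod I₂) p => w.1) h0)
    (Prod.ext (congrArg (fun w : TractorFibre (I₁.prod I₂) p => w.2.1.2) h0)
      (congrArg (fun w : TractorFibre (I₁.prod I₂) p => w.2.2) h0)))

theorem liftFst_neg {V W : TractorField I₁ M₁} {p : M₁ × M₂} (h : V p.1 = -W p.1) :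
    liftFst I₁ M₁ I₂ M₂ V p = -liftFst I₁ M₁ I₂ M₂ W p := by
  simp only [liftFst, h]
  exact Prod.ext rfl (Prod.ext (Prod.ext rfl neg_zero.symm) rfl)

theorem liftSnd_neg {V W : TractorField I₂ M₂} {p : M₁ × M₂} (h : V p.2 = -W p.2) :
    liftSnd I₁ M₁ I₂ M₂ V p = -liftSnd I₁ M₁ I₂ M₂ W p := by
  simp only [liftSnd, h]
  exact Prod.ext rfl (Prod.ext (Prod.ext neg_zero.symm rfl) rfl)

variable {g₁ : Metric I₁ M₁} {c₁ : ℝ} {g₂ : Metric I₂ M₂} {c₂ : ℝ}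

theorem isAE_liftFst (h₁₂ : c₂ = -c₁) {A : Set (Opens M₁ × TractorField I₁ M₁)}
    (hA : IsAE g₁ (constSchouten g₁ c₁) A)
    (h0 : ∀ a ∈ A, ∀ x ∈ a.1, einsteinPairing c₁ (a.2 x) = 0) :
    IsAE (prodMetric g₁ g₂) (prodSchouten g₁ c₁ g₂ c₂)
      ((fun a => (a.1.comap ⟨Prod.fst, continuous_fst⟩, liftFst I₁ M₁ I₂ M₂ a.2)) '' A) := by
  refine ⟨fun p => ?_, ?_, ?_, ?_⟩
  · obtain ⟨a, ha, hx⟩ := hA.cover p.1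
    exact ⟨_, Set.mem_image_of_mem _ ha, hx⟩
  · rintro - ⟨a, ha, rfl⟩
    exact isParallelOn_liftFst g₂ h₁₂ (hA.parallel a ha) (h0 a ha)
  · rintro - ⟨a, ha, rfl⟩ p hp
    exact liftFst_ne_zero (hA.ne_zero a ha p.1 hp)
  · rintro - ⟨a, ha, rfl⟩ - ⟨b, hb, rfl⟩
    refine (hA.overlap a ha b hb).imp (fun h p hp => ?_) fun h p hp => liftFst_neg (h p.1 hp)
    simp only [liftFst, h p.1 hp]

theorem isAE_liftSnd (h₁₂ : c₂ = -c₁) {A : Set (Opens M₂ × TractorField I₂ M₂)}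
    (hA : IsAE g₂ (constSchouten g₂ c₂) A)
    (h0 : ∀ a ∈ A, ∀ x ∈ a.1, einsteinPairing c₂ (a.2 x) = 0) :
    IsAE (prodMetric g₁ g₂) (prodSchouten g₁ c₁ g₂ c₂)
      ((fun a => (a.1.comap ⟨Prod.snd, continuous_snd⟩, liftSnd I₁ M₁ I₂ M₂ a.2)) '' A) := by
  refine ⟨fun p => ?_, ?_, ?_, ?_⟩
  · obtain ⟨a, ha, hx⟩ := hA.cover p.2
    exact ⟨_, Set.mem_image_of_mem _ ha, hx⟩
  · rintro - ⟨a, ha, rfl⟩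
    exact isParallelOn_liftSnd g₁ h₁₂ (hA.parallel a ha) (h0 a ha)
  · rintro - ⟨a, ha, rfl⟩ p hp
    exact liftSnd_ne_zero (hA.ne_zero a ha p.2 hp)
  · rintro - ⟨a, ha, rfl⟩ - ⟨b, hb, rfl⟩
    refine (hA.overlap a ha b hb).imp (fun h p hp => ?_) fun h p hp => liftSnd_neg (h p.2 hp)
    simp only [liftSnd, h p.2 hp]

/-- At a point where the tractor is non-zero one of its two components is non-zero, and that
component on the slice through the point is a second structure besides `Jᵢ`. Conversely, an
orthogonal structure of a factor is lifted. -/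
theorem admitsDirectedAE_prod_iff (hc : c₁ ≠ 0) (h₁₂ : c₂ = -c₁)
    {J₁ : TractorField I₁ M₁} (hJ₁ : IsParallelOn g₁ (constSchouten g₁ c₁) J₁ ⊤)
    (hJ₁0 : ∀ x, einsteinPairing c₁ (J₁ x) ≠ 0)
    {J₂ : TractorField I₂ M₂} (hJ₂ : IsParallelOn g₂ (constSchouten g₂ c₂) J₂ ⊤)
    (hJ₂0 : ∀ x, einsteinPairing c₂ (J₂ x) ≠ 0) :
    AdmitsDirectedAE (prodMetric g₁ g₂) (prodSchouten g₁ c₁ g₂ c₂) ↔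
      AdmitsTwoDirectedAE g₁ (constSchouten g₁ c₁) ∨
        AdmitsTwoDirectedAE g₂ (constSchouten g₂ c₂) := by
  have hc₂ : c₂ ≠ 0 := by rw [h₁₂]; exact neg_ne_zero.2 hc
  constructor
  · rintro ⟨V, hV, hne⟩
    obtain ⟨p, hp⟩ := Function.ne_iff.1 hne
    by_cases h1 : splitFst c₁ p (V p) = 0
    · have h2 : splitSnd c₂ p (V p) ≠ 0 := fun h2 => hp (eq_zero_of_split_eq_zero h₁₂ h1 h2)
      exact Or.inr (admitsTwoDirectedAE_of_orthogonal hJ₂ hJ₂0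
        (isParallelOn_slice_snd hc₂ hV p.1) (fun y => einsteinPairing_splitSnd hc₂ _ _)
        (x := p.2) h2)
    · exact Or.inl (admitsTwoDirectedAE_of_orthogonal hJ₁ hJ₁0
        (isParallelOn_slice_fst hc hV p.2) (fun x => einsteinPairing_splitFst hc _ _)
        (x := p.1) h1)
  · obtain ⟨x₀⟩ := (inferInstance : Nonempty M₁)
    obtain ⟨y₀⟩ := (inferInstance : Nonempty M₂)
    rintro (h | h)
    · obtain ⟨V, hV, h0⟩ := h.exists_orthogonal
      obtain ⟨x, hx⟩ := Function.ne_iff.1 hV.ne_zero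
      exact ⟨_, isParallelOn_liftFst g₂ h₁₂ hV.parallel fun x _ => h0 x,
        fun hz => liftFst_ne_zero (p := (x, y₀)) hx (congrFun hz (x, y₀))⟩
    · obtain ⟨V, hV, h0⟩ := h.exists_orthogonal
      obtain ⟨y, hy⟩ := Function.ne_iff.1 hV.ne_zero
      exact ⟨_, isParallelOn_liftSnd g₁ h₁₂ hV.parallel fun x _ => h0 x,
        fun hz => liftSnd_ne_zero (p := (x₀, y)) hy (congrFun hz (x₀, y))⟩

/-- The restriction to the slice `M₁ × {y}` of a family of local tractor fields. -/
def sliceFamilyFst (c : ℝ) (y : M₂)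
    (A : Set (Opens (M₁ × M₂) × TractorField (I₁.prod I₂) (M₁ × M₂))) :
    Set (Opens M₁ × TractorField I₁ M₁) :=
  (fun a => (sliceOpenFst a.1 y, fun x => splitFst c (x, y) (a.2 (x, y)))) '' A

/-- The restriction to the slice `{x} × M₂` of a family of local tractor fields. -/
def sliceFamilySnd (c : ℝ) (x : M₁)
    (A : Set (Opens (M₁ × M₂) × TractorField (I₁.prod I₂) (M₁ × M₂))) :
    Set (Opens M₂ × TractorField I₂ M₂) :=
  (fun a => (sliceOpenSnd a.1 x, fun y => splitSnd c (x, y) (a.2 (x, y)))) '' A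

variable {A : Set (Opens (M₁ × M₂) × TractorField (I₁.prod I₂) (M₁ × M₂))}

theorem isAE_sliceFamilyFst (hc : c₁ ≠ 0)
    (hA : IsAE (prodMetric g₁ g₂) (prodSchouten g₁ c₁ g₂ c₂) A) {y : M₂}
    (h0 : ∀ a ∈ A, ∀ x, (x, y) ∈ a.1 → splitFst c₁ (x, y) (a.2 (x, y)) ≠ 0) :
    IsAE g₁ (constSchouten g₁ c₁) (sliceFamilyFst c₁ y A) := by
  refine ⟨fun x => ?_, ?_, ?_, ?_⟩
  · obtain ⟨a, ha, hx⟩ := hA.cover (x, y)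
    exact ⟨_, Set.mem_image_of_mem _ ha, hx⟩
  · rintro - ⟨a, ha, rfl⟩
    exact isParallelOn_slice_fst hc (hA.parallel a ha) y
  · rintro - ⟨a, ha, rfl⟩ x hx
    exact h0 a ha x hx
  · rintro - ⟨a, ha, rfl⟩ - ⟨b, hb, rfl⟩
    refine (hA.overlap a ha b hb).imp (fun h x hx => ?_) fun h x hx => ?_
    · simp only [h (x, y) hx]
    · simp only [h (x, y) hx, splitFst_neg]

theorem isAE_sliceFamilySnd (hc : c₂ ≠ 0)
    (hA : IsAE (prodMetric g₁ g₂) (prodSchouten g₁ c₁ g₂ c₂) A) {x : M₁}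
    (h0 : ∀ a ∈ A, ∀ y, (x, y) ∈ a.1 → splitSnd c₂ (x, y) (a.2 (x, y)) ≠ 0) :
    IsAE g₂ (constSchouten g₂ c₂) (sliceFamilySnd c₂ x A) := by
  refine ⟨fun y => ?_, ?_, ?_, ?_⟩
  · obtain ⟨a, ha, hx⟩ := hA.cover (x, y)
    exact ⟨_, Set.mem_image_of_mem _ ha, hx⟩
  · rintro - ⟨a, ha, rfl⟩
    exact isParallelOn_slice_snd hc (hA.parallel a ha) x
  · rintro - ⟨a, ha, rfl⟩ y hy
    exact h0 a ha y hy
  · rintro - ⟨a, ha, rfl⟩ - ⟨b, hb, rfl⟩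
    refine (hA.overlap a ha b hb).imp (fun h y hy => ?_) fun h y hy => ?_
    · simp only [h (x, y) hy]
    · simp only [h (x, y) hy, splitSnd_neg]

/-- The squared norm is even, so it is well defined along the connected slice despite the signs. It
is used to exclude zeros. -/
theorem exists_const_tractorNormSq_slice_fst (hc : c₁ ≠ 0)
    (hA : IsAE (prodMetric g₁ g₂) (prodSchouten g₁ c₁ g₂ c₂) A) (y : M₂) :
    ∃ K, ∀ a ∈ A, ∀ x, (x, y) ∈ a.1 → tractorNormSq g₁ x (splitFst c₁ (x, y) (a.2 (x, y))) = K := by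
  obtain ⟨K, hK⟩ := exists_const_of_isCriticalAt (I := I₁)
    (fun a : A => sliceOpenFst a.1.1 y)
    (fun a x => tractorNormSq g₁ x (splitFst c₁ (x, y) (a.1.2 (x, y))))
    (fun x => by obtain ⟨a, ha, hx⟩ := hA.cover (x, y); exact ⟨⟨a, ha⟩, hx⟩)
    (fun a x hx =>
      isCriticalAt_tractorNormSq (isParallelOn_slice_fst hc (hA.parallel a.1 a.2) y) hx)
    (fun a b x hx hx' => by
      rcases hA.overlap a.1 a.2 b.1 b.2 with h | h
      · simp only [h (x, y) ⟨hx, hx'⟩]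
      · simp only [h (x, y) ⟨hx, hx'⟩, splitFst_neg]
        exact tractorNormSq_neg g₁ _)
  exact ⟨K, fun a ha x hx => hK ⟨a, ha⟩ x hx⟩

theorem exists_const_tractorNormSq_slice_snd (hc : c₂ ≠ 0)
    (hA : IsAE (prodMetric g₁ g₂) (prodSchouten g₁ c₁ g₂ c₂) A) (x : M₁) :
    ∃ K, ∀ a ∈ A, ∀ y, (x, y) ∈ a.1 → tractorNormSq g₂ y (splitSnd c₂ (x, y) (a.2 (x, y))) = K := by
  obtain ⟨K, hK⟩ := exists_const_of_isCriticalAt (I := I₂)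
    (fun a : A => sliceOpenSnd a.1.1 x)
    (fun a y => tractorNormSq g₂ y (splitSnd c₂ (x, y) (a.1.2 (x, y))))
    (fun y => by obtain ⟨a, ha, hy⟩ := hA.cover (x, y); exact ⟨⟨a, ha⟩, hy⟩)
    (fun a y hy =>
      isCriticalAt_tractorNormSq (isParallelOn_slice_snd hc (hA.parallel a.1 a.2) x) hy)
    (fun a b y hy hy' => by
      rcases hA.overlap a.1 a.2 b.1 b.2 with h | h
      · simp only [h (x, y) ⟨hy, hy'⟩]
      · simp only [h (x, y) ⟨hy, hy'⟩, splitSnd_neg]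
        exact tractorNormSq_neg g₂ _)
  exact ⟨K, fun a ha y hy => hK ⟨a, ha⟩ y hy⟩

/-- One of the two components of an almost Einstein structure on a product vanishes nowhere on some
slice. -/
theorem exists_slice_ne_zero (hc : c₁ ≠ 0) (h₁₂ : c₂ = -c₁)
    (hA : IsAE (prodMetric g₁ g₂) (prodSchouten g₁ c₁ g₂ c₂) A) :
    (∃ y : M₂, ∀ a ∈ A, ∀ x, (x, y) ∈ a.1 → splitFst c₁ (x, y) (a.2 (x, y)) ≠ 0) ∨
      ∃ x : M₁, ∀ a ∈ A, ∀ y, (x, y) ∈ a.1 → splitSnd c₂ (x, y) (a.2 (x, y)) ≠ 0 := by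
  have hc₂ : c₂ ≠ 0 := by rw [h₁₂]; exact neg_ne_zero.2 hc
  choose K₁ hK₁ using exists_const_tractorNormSq_slice_fst hc hA
  choose K₂ hK₂ using exists_const_tractorNormSq_slice_snd hc₂ hA
  by_cases h₁ : ∃ y, K₁ y ≠ 0
  · obtain ⟨y, hy⟩ := h₁
    refine Or.inl ⟨y, fun a ha x hx h0 => hy ?_⟩
    rw [← hK₁ y a ha x hx, h0]
    exact tractorNormSq_zero g₁ x
  by_cases h₂ : ∃ x, K₂ x ≠ 0
  · obtain ⟨x, hx⟩ := h₂
    refine Or.inr ⟨x, fun a ha y hy h0 => hx ?_⟩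
    rw [← hK₂ x a ha y hy, h0]
    exact tractorNormSq_zero g₂ y
  push Not at h₁ h₂
  obtain ⟨x₀⟩ := (inferInstance : Nonempty M₁)
  obtain ⟨y₀⟩ := (inferInstance : Nonempty M₂)
  -- Both components are null everywhere. On the factor with positive constant this forces the
  -- component to vanish, so a zero of the other would be a zero of the whole tractor; any slice
  -- will do.
  rcases lt_or_gt_of_ne hc with hneg | hpos
  · have hpos₂ : 0 < c₂ := by linarith
    refine Or.inl ⟨y₀, fun a ha x hx h0 => hA.ne_zero a ha (x, y₀) hx ?_⟩
    exact eq_zero_of_split_eq_zero h₁₂ h0 (eq_zero_of_tractorNormSq_eq_zero hpos₂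
      ((hK₂ x a ha y₀ hx).trans (h₂ x)) (einsteinPairing_splitSnd hc₂ _ _))
  · refine Or.inr ⟨x₀, fun a ha y hy h0 => hA.ne_zero a ha (x₀, y) hy ?_⟩
    exact eq_zero_of_split_eq_zero h₁₂ (eq_zero_of_tractorNormSq_eq_zero hpos
      ((hK₁ y a ha x₀ hy).trans (h₁ y)) (einsteinPairing_splitFst hc _ _)) h0

/-- Here a component has to be nowhere zero on an entire slice, and `exists_slice_ne_zero` supplies
such a slice in one of the two factors. -/
theorem admitsAE_prod_iff (hc : c₁ ≠ 0) (h₁₂ : c₂ = -c₁)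
    {J₁ : TractorField I₁ M₁} (hJ₁ : IsParallelOn g₁ (constSchouten g₁ c₁) J₁ ⊤)
    (hJ₁0 : ∀ x, einsteinPairing c₁ (J₁ x) ≠ 0)
    {J₂ : TractorField I₂ M₂} (hJ₂ : IsParallelOn g₂ (constSchouten g₂ c₂) J₂ ⊤)
    (hJ₂0 : ∀ x, einsteinPairing c₂ (J₂ x) ≠ 0) :
    AdmitsAE (prodMetric g₁ g₂) (prodSchouten g₁ c₁ g₂ c₂) ↔
      AdmitsTwoAE g₁ (constSchouten g₁ c₁) ∨ AdmitsTwoAE g₂ (constSchouten g₂ c₂) := by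
  have hc₂ : c₂ ≠ 0 := by rw [h₁₂]; exact neg_ne_zero.2 hc
  constructor
  · rintro ⟨A, hA⟩
    rcases exists_slice_ne_zero hc h₁₂ hA with ⟨y, hy⟩ | ⟨x, hx⟩
    · refine Or.inl (admitsTwoAE_of_orthogonal hJ₁ hJ₁0 (isAE_sliceFamilyFst hc hA hy) ?_)
      rintro - ⟨a, ha, rfl⟩ x -
      exact einsteinPairing_splitFst hc _ _
    · refine Or.inr (admitsTwoAE_of_orthogonal hJ₂ hJ₂0 (isAE_sliceFamilySnd hc₂ hA hx) ?_)
      rintro - ⟨a, ha, rfl⟩ y -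
      exact einsteinPairing_splitSnd hc₂ _ _
  · rintro (h | h)
    · obtain ⟨A, hA, h0⟩ := h.exists_orthogonal
      exact ⟨_, isAE_liftFst h₁₂ hA h0⟩
    · obtain ⟨A, hA, h0⟩ := h.exists_orthogonal
      exact ⟨_, isAE_liftSnd h₁₂ hA h0⟩

end ProductAlmostEinstein

end ConformalTractor

end

/-! ### The theorem -/

open ConformalTractor

theorem theorem3p1 (m₁ m₂ : ℕ)
    (M₁ : Type*) [TopologicalSpace M₁] [T2Space M₁] [SecondCountableTopology M₁]
    [ConnectedSpace M₁] [ChartedSpace (EuclideanSpace ℝ (Fin m₁)) M₁] [IsManifold (𝓡 m₁) ∞ M₁]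
    (M₂ : Type*) [TopologicalSpace M₂] [T2Space M₂] [SecondCountableTopology M₂]
    [ConnectedSpace M₂] [ChartedSpace (EuclideanSpace ℝ (Fin m₂)) M₂] [IsManifold (𝓡 m₂) ∞ M₂]
    (g₁ : Metric (𝓡 m₁) M₁) (c₁ : ℝ) (I₁ : TractorField (𝓡 m₁) M₁)
    (g₂ : Metric (𝓡 m₂) M₂) (c₂ : ℝ) (I₂ : TractorField (𝓡 m₂) M₂)
    (h : IsSpecialEinsteinProduct g₁ c₁ g₂ c₂ I₁ I₂) :
    (AdmitsDirectedAE (prodMetric g₁ g₂) (schouten (prodMetric g₁ g₂)) ↔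
      AdmitsTwoDirectedAE g₁ (einsteinSchouten g₁ c₁) ∨
        AdmitsTwoDirectedAE g₂ (einsteinSchouten g₂ c₂)) ∧
    (AdmitsAE (prodMetric g₁ g₂) (schouten (prodMetric g₁ g₂)) ↔
      AdmitsTwoAE g₁ (einsteinSchouten g₁ c₁) ∨
        AdmitsTwoAE g₂ (einsteinSchouten g₂ c₂)) := by
  obtain ⟨x⟩ := (inferInstance : Nonempty M₁)
  obtain ⟨y⟩ := (inferInstance : Nonempty M₂)
  have e₁ : einsteinSchouten g₁ c₁ = constSchouten g₁ c₁ :=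
    funext fun x => einsteinSchouten_eq h.dim₁ h.einstein₁ h.constant₁ x
  have e₂ : einsteinSchouten g₂ c₂ = constSchouten g₂ c₂ :=
    funext fun y => einsteinSchouten_eq h.dim₂ h.einstein₂ h.constant₂ y
  have p₁ := h.tractor₁.parallel
  have p₂ := h.tractor₂.parallel
  rw [e₁] at p₁
  rw [e₂] at p₂
  have t₁ := einsteinTractor_eq h.dim₁ p₁ h.tractor₁.scale
  have t₂ := einsteinTractor_eq h.dim₂ p₂ h.tractor₂.scale
  -- The squared norm of `(1, 0, -c)` is `-2 c`; the norm conditions thus become `c₁ ≠ 0` and `c₂ =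
  -- -c₁`.
  have n₁ : tractorNormSq g₁ x (I₁ x) = -2 * c₁ := by
    simp [tractorNormSq, t₁]
  have n₂ : tractorNormSq g₂ y (I₂ y) = -2 * c₂ := by
    simp [tractorNormSq, t₂]
  have hc : c₁ ≠ 0 := by
    rintro rfl
    exact h.norm_ne x (by rw [n₁]; ring)
  have h₁₂ : c₂ = -c₁ := by
    have := h.norm_eq x y
    rw [n₁, n₂] at this
    linarith
  -- The pairing of the Einstein tractor with itself is `-2 c₁`.
  have j₁ : ∀ x, einsteinPairing c₁ (I₁ x) ≠ 0 := fun x h0 => hc (by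
    rw [t₁, einsteinPairing] at h0
    linarith)
  have j₂ : ∀ y, einsteinPairing c₂ (I₂ y) ≠ 0 := fun y h0 => hc (by
    rw [t₂, einsteinPairing] at h0
    linarith)
  have e : schouten (prodMetric g₁ g₂) = prodSchouten g₁ c₁ g₂ c₂ := by
    funext p
    have hc₂ := h.constant₂
    rw [h₁₂] at hc₂ ⊢
    exact schouten_prod h.dim₁ h.dim₂ h.dim h.einstein₁ h.einstein₂ h.constant₁ hc₂ p
  rw [e, e₁, e₂]
  exact ⟨admitsDirectedAE_prod_iff hc h₁₂ p₁ j₁ p₂ j₂, admitsAE_prod_iff hc h₁₂ p₁ j₁ p₂ j₂⟩
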